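/- Let $\mathbb T_2=[-\pi,\pi]^2$ with opposite sides identified, $\mathbf Z^2_\star=\mathbf Z^2\setminus\{0\}$, $e_k(x)=(2\pi)^{-1}\mathrm e^{\mathrm i k\cdot x}$, and for $s\in\mathbf R$ let $\mathring H^s$ be the space of zero-mean periodic distributions $u=\sum_{k\in\mathbf Z^2_\star}u_ke_k$ with $\|u\|_{H^s}^2=\sum_{k\in\mathbf Z^2_\star}|k|^{2s}|u_k|^2<\infty$. Let $W$ be a cylindrical Wiener process on the space $\mathring L^2(\mathbb T_2)$ of real square integrable functions with zero mean, defined on some probability space, i.e. its components $\beta_k=\langle W,e_k\rangle$, $k\in\mathbf Z^2_\star$, satisfy $\beta_{-k}=\overline{\beta_k}$ and $(\beta_k)_{k\in\mathbf Z^2_+}$ are independent standard complex Brownian motions (with $\mathbb E|\beta_k(t)|^2=t$), where $\mathbf Z^2_+=\{k\in\mathbf Z^2: k_1>0\text{ or }k_1=0,k_2>0\}$. Let $z(t)=\int_0^t \mathrm e^{-(t-s)\Delta^2}\,dW_s$ be the stochastic convolution, that is $$z(t)=\sum_{k\in\mathbf Z^2_\star}z_k(t)e_k,\qquad z_k(t)=\int_0^t\mathrm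 e^{-|k|^4(t-s)}\,d\beta_k(s).$$ Let $\mathcal B(u,v)=\Delta(\nabla u\cdot\overline{\nabla v})$ and $\mathcal B_N(u,v)=\mathcal B(\pi_Nu,\pi_Nv)$, where $\pi_N u=\sum_{0<|k|\le N}u_ke_k$. Then for every $\gamma>0$ and every $p>1$ there is a constant $c>0$, depending only on $\gamma$ and $p$, such that the following holds. For every $t>0$ the limit $$\widetilde{\mathcal B}(z(t),z(t))=\lim_{N\to\infty}\mathcal B_N(z(t),z(t))\quad\text{in }L^2(\Omega;\mathring H^{-2-\gamma})$$ exists, and $$\sup_{t>0}\mathbb E\bigl[\|\widetilde{\mathcal B}(z(t),z(t))\|_{H^{-2-\gamma}}^p\bigr]\le c .$$ -/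

import Mathlib

open MeasureTheory ProbabilityTheory Filter Topology
open scoped NNReal ENNReal

namespace SurfaceGrowth

noncomputable section

/-! ### Fourier modes on the two-dimensional torus -/

/-- The plane; functions on the torus `[-π, π]²` with identified borders are functions on the
plane that are `2π`-periodic in each coordinate. -/
abbrev Plane : Type := EuclideanSpace ℝ (Fin 2)

/-- The set `ℤ²_⋆` of nonzero integer vectors. -/
abbrev Mode : Type := {k : Fin 2 → ℤ // k ≠ 0}

/-- The mode `-k`. -/
def Mode.opp (k : Mode) : Mode := ⟨-k.1, neg_ne_zero.2 k.2⟩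

/-- The half-lattice `ℤ²_+`: `k₁ > 0`, or `k₁ = 0` and `k₂ > 0`. -/
def Mode.IsPositive (k : Mode) : Prop := 0 < k.1 0 ∨ (k.1 0 = 0 ∧ 0 < k.1 1)

/-- The Euclidean length `|k|`. -/
def Mode.length (k : Mode) : ℝ := Real.sqrt ((k.1 0 : ℝ) ^ 2 + (k.1 1 : ℝ) ^ 2)

/-- The modes with `0 < |k| ≤ N`. -/
def modesUpTo (N : ℕ) : Finset Mode :=
  Finset.subtype (fun k : Fin 2 → ℤ => k ≠ 0)
    ((Fintype.piFinset fun _ : Fin 2 => Finset.Icc (-(N : ℤ)) (N : ℤ)).filter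
      fun k => k 0 ^ 2 + k 1 ^ 2 ≤ (N : ℤ) ^ 2)

theorem mem_modesUpTo (N : ℕ) (k : Mode) : k ∈ modesUpTo N ↔ k.length ≤ N := by
  have key : k.length ≤ N ↔ k.1 0 ^ 2 + k.1 1 ^ 2 ≤ (N : ℤ) ^ 2 := by
    unfold Mode.length
    rw [Real.sqrt_le_left (by positivity)]
    exact_mod_cast Iff.rfl
  rw [key]
  simp only [modesUpTo, Finset.mem_subtype, Finset.mem_filter, Fintype.mem_piFinset,
    Finset.mem_Icc, Fin.forall_fin_two, and_iff_right_iff_imp]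
  intro h
  refine ⟨⟨?_, ?_⟩, ?_, ?_⟩ <;> nlinarith [sq_nonneg (k.1 0), sq_nonneg (k.1 1)]

/-- The Fourier basis `e_k(x) = (2π)⁻¹ exp(i k·x)`. -/
def basisFun (k : Mode) (x : Plane) : ℂ :=
  (((2 * Real.pi)⁻¹ : ℝ) : ℂ) *
    Complex.exp (Complex.I * (((k.1 0 : ℝ) * x 0 + (k.1 1 : ℝ) * x 1 : ℝ) : ℂ))

/-- The fundamental cell `[-π, π]²`. -/
def cell : Set Plane := {x | ∀ i, x i ∈ Set.Icc (-Real.pi) Real.pi}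

/-- The Fourier coefficients `⟨g, e_k⟩ = ∫ g conj(e_k)`, for `k ≠ 0`. -/
def coeff (g : Plane → ℂ) (k : Mode) : ℂ :=
  ∫ x in cell, g x * (starRingEnd ℂ) (basisFun k x)

/-- The norm of the zero-mean periodic Sobolev space of order `s`, for any real `s`: a zero-mean
periodic distribution is represented by its family of Fourier coefficients `a`, its norm is
`(∑_{k ≠ 0} |k|^{2s} |a_k|²)^{1/2}`, and it belongs to the space when this is finite. -/
def sobolevNorm (s : ℝ) (a : Mode → ℂ) : ℝ≥0∞ :=
  (∑' k : Mode, ENNReal.ofReal (k.length ^ (2 * s)) * ‖a k‖ₑ ^ 2) ^ (1 / 2 : ℝ)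

/-! ### The nonlinearity and its Galerkin truncations -/

/-- The partial derivative in the direction of the `j`-th coordinate. -/
def partialDeriv (j : Fin 2) (u : Plane → ℂ) (x : Plane) : ℂ :=
  lineDeriv ℝ u x (EuclideanSpace.single j (1 : ℝ))

/-- `B(u, v) = Δ(∇u · conj(∇v))`; the conjugation is immaterial for real valued `v`. -/
def nonlin (u v : Plane → ℂ) : Plane → ℂ :=
  Laplacian.laplacian fun x : Plane =>
    ∑ j : Fin 2, partialDeriv j u x * (starRingEnd ℂ) (partialDeriv j v x)

/-- The projection `π_N u = ∑_{0 < |k| ≤ N} u_k e_k` of the (generalized) function with Fourier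
coefficients `u_k`. -/
def galerkinProj (N : ℕ) (u : Mode → ℂ) (x : Plane) : ℂ :=
  ∑ k ∈ modesUpTo N, u k * basisFun k x

/-- The Fourier coefficients of `B_N(u, v) = B(π_N u, π_N v)`, where `u` and `v` are given by their
Fourier coefficients. -/
def galerkinNonlin (N : ℕ) (u v : Mode → ℂ) : Mode → ℂ :=
  coeff (nonlin (galerkinProj N u) (galerkinProj N v))

/-! ### The noise and the stochastic convolution -/

section Noise

variable {Ω : Type*} [MeasurableSpace Ω]

/-- `β` is the family of Fourier components `β_k(t) = ⟨W_t, e_k⟩`, `k ≠ 0`, of a (real) cylindrical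
Wiener process `W` on the zero-mean square integrable functions on the torus: `β_{-k} = conj β_k`,
and the `β_k` with `k ∈ ℤ²_+` are independent standard complex Brownian motions, that is,
`√2 Re β_k` and `√2 Im β_k`, `k ∈ ℤ²_+`, are independent standard real Brownian motions
(so that `E |β_k(t)|² = t`). -/
structure IsCylindricalWiener (P : Measure Ω) (β : Mode → ℝ≥0 → Ω → ℂ) : Prop where
  conj_symm : ∀ (k : Mode) (t : ℝ≥0), ∀ᵐ ω ∂P, β k.opp t ω = (starRingEnd ℂ) (β k t ω)
  brownian_re : ∀ k : Mode, k.IsPositive →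
    IsBrownianReal (fun (t : ℝ≥0) ω => Real.sqrt 2 * (β k t ω).re) P
  brownian_im : ∀ k : Mode, k.IsPositive →
    IsBrownianReal (fun (t : ℝ≥0) ω => Real.sqrt 2 * (β k t ω).im) P
  indep : iIndepFun (fun (i : {k : Mode // k.IsPositive} × Bool) (ω : Ω) (t : ℝ≥0) =>
    if i.2 then (β i.1.1 t ω).re else (β i.1.1 t ω).im) P

/-- An elementary (step) function `∑_{i < m} a_i 1_{(τ_i, τ_{i+1}]}` of time. -/
structure ElementaryFunction where
  m : ℕ
  τ : ℕ → ℝ≥0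
  a : ℕ → ℝ
  mono : Monotone τ

/-- The value of an elementary function. -/
def ElementaryFunction.value (φ : ElementaryFunction) (s : ℝ) : ℝ :=
  ∑ i ∈ Finset.range φ.m,
    (Set.Ioc (φ.τ i : ℝ) (φ.τ (i + 1) : ℝ)).indicator (fun _ => φ.a i) s

/-- The integral `∑_{i < m} a_i (X(τ_{i+1}) - X(τ_i))` of an elementary function against `X`. -/
def ElementaryFunction.integral (φ : ElementaryFunction) (X : ℝ≥0 → Ω → ℂ) (ω : Ω) : ℂ :=
  ∑ i ∈ Finset.range φ.m, (φ.a i : ℂ) * (X (φ.τ (i + 1)) ω - X (φ.τ i) ω)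

/-- The random variable `Y` is (a version of) the Wiener integral `∫_0^t f(s) dX(s)` of the
deterministic function `f`: the limit in `L²(Ω)` of the integrals of elementary functions on
`[0, t]` that converge to `f` in `L²(0, t)`. -/
def IsWienerIntegral (P : Measure Ω) (X : ℝ≥0 → Ω → ℂ) (t : ℝ≥0) (f : ℝ → ℝ) (Y : Ω → ℂ) : Prop :=
  AEMeasurable Y P ∧
  ∃ φ : ℕ → ElementaryFunction,
    (∀ n i, (φ n).τ i ≤ t) ∧
    Tendsto (fun n => eLpNorm (fun s => f s - (φ n).value s) 2
      (volume.restrict (Set.Ioc (0 : ℝ) (t : ℝ)))) atTop (𝓝 0) ∧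
    Tendsto (fun n => eLpNorm (fun ω => Y ω - (φ n).integral X ω) 2 P) atTop (𝓝 0)

/-- `z` is (a version of) the stochastic convolution `z(t) = ∫_0^t S(t-s) dW_s`, where `S` is the
semigroup generated by `-Δ²`, given by its Fourier coefficients
`z_k(t) = ∫_0^t exp(-|k|⁴ (t-s)) dβ_k(s)`. -/
def IsStochasticConvolution (P : Measure Ω) (β : Mode → ℝ≥0 → Ω → ℂ)
    (z : ℝ≥0 → Ω → Mode → ℂ) : Prop :=
  ∀ (k : Mode) (t : ℝ≥0),
    IsWienerIntegral P (β k) t (fun s => Real.exp (-(k.length ^ 4) * ((t : ℝ) - s)))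
      (fun ω => z t ω k)

/-- `b` is (a version of) the renormalized nonlinearity `B̃(u, u)` of the random distribution `u`:
the limit of `B_N(u, u)` in `L²(Ω; H^s)`. Random distributions are given by their Fourier
coefficients. -/
def IsRenormalizedNonlin (P : Measure Ω) (s : ℝ) (u b : Ω → Mode → ℂ) : Prop :=
  (∀ k, AEMeasurable (fun ω => b ω k) P) ∧
  Tendsto (fun N : ℕ =>
    ∫⁻ ω, sobolevNorm s (fun k => galerkinNonlin N (u ω) (u ω) k - b ω k) ^ 2 ∂P) atTop (𝓝 0)

end Noise

end

end SurfaceGrowth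

open SurfaceGrowth

namespace SurfaceGrowth

noncomputable section

/-! ### Second moments -/

/-! In Fourier variables the `m`-th coefficient of `B_N(z, z)` is the quadratic form `-(2π)⁻¹ |m|² ∑
(k·l) z_k conj(z_l)` over `k - l = m` with `|k|, |l| ≤ N` (`galerkinNonlin_eq`). Since `m ≠ 0`, the
diagonal `k = l` never occurs (`bilinearKernel_self`). The only part with divergent expectation sits
in the mode `m = 0`, which the Laplacian kills, so no counterterm is needed.

What remains is an off-diagonal quadratic form in a centered Gaussian vector with orthogonal
coordinates. All its moments are controlled by a Hilbert-Schmidt norm weighted by the variances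
(`IsOrthogonalGaussian.eLpNorm_sesq_self_le`). This is proved by decoupling. The form has mean zero,
so subtracting an independent copy can only increase the norm. Rotating the pair by `π / 4`
preserves its law and turns `Q(x, x) - Q(y, y)` into `Q(x, y) + Q(y, x)`. The bilinear form `Q(x,
y)` is linear Gaussian in each variable separately, so the equivalence of Gaussian moments applies
twice. The bound is proved for Wiener integrals of step functions and passes to `z(t)` by the Itô
isometry and Fatou's lemma.

The variance of `z_k(t)` is at most `1 / (2|k|⁴)` for every `t`, which makes the estimates uniform
in time. In `H^{-2-γ}` the total weight is bounded, up to a constant, by `∑ |m|^{-2γ} |k|⁻² |l|⁻²`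
over `k - l = m`. It is finite in two dimensions (`tsum_bilinearKernel_ne_top`), because the larger
of `|k|, |l|` is at least `|m| / 2`. The tails of this sum give the convergence in `L²`. Minkowski's
inequality for the squared Sobolev norm gives the higher moments
(`IsRenormalizedNonlin.lintegral_sobolevNorm_rpow_le`). -/

theorem eLpNorm_two_sq {α ε : Type*} [MeasurableSpace α] [ENorm ε] (f : α → ε) (μ : Measure α) :
    eLpNorm f 2 μ ^ 2 = ∫⁻ x, ‖f x‖ₑ ^ 2 ∂μ := by
  rw [eLpNorm_eq_lintegral_rpow_enorm_toReal two_ne_zero ENNReal.ofNat_ne_top]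
  simp only [ENNReal.toReal_ofNat, ENNReal.rpow_ofNat]
  rw [← ENNReal.rpow_natCast, ← ENNReal.rpow_mul]
  norm_num

theorem eLpNorm_two_sq_eq_ofReal {α E : Type*} [MeasurableSpace α] [NormedAddCommGroup E]
    {f : α → E} {μ : Measure α} (hf : MemLp f 2 μ) :
    eLpNorm f 2 μ ^ 2 = ENNReal.ofReal (∫ x, ‖f x‖ ^ 2 ∂μ) := by
  rw [eLpNorm_two_sq, ofReal_integral_eq_lintegral_ofReal hf.norm.integrable_sq
    (Eventually.of_forall fun x => by positivity)]
  refine lintegral_congr fun x => ?_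
  rw [ENNReal.ofReal_pow (norm_nonneg _), ofReal_norm]

theorem integrable_mul_conj {α : Type*} [MeasurableSpace α] {μ : Measure α} {f g : α → ℂ}
    (hf : MemLp f 2 μ) (hg : MemLp g 2 μ) :
    Integrable (fun x => f x * (starRingEnd ℂ) (g x)) μ :=
  hf.integrable_mul (q := 2) hg.star

/-- Pythagoras for a finite linear combination of orthogonal square integrable functions. -/
theorem eLpNorm_two_sq_sum_of_orthogonal {α ι : Type*} [MeasurableSpace α] [Fintype ι]
    {μ : Measure α} {X : ι → α → ℂ} (hX : ∀ k, MemLp (X k) 2 μ)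
    (orth : ∀ k l, k ≠ l → ∫ x, X k x * (starRingEnd ℂ) (X l x) ∂μ = 0) (c : ι → ℂ) :
    eLpNorm (fun x => ∑ k, c k * X k x) 2 μ ^ 2 = ∑ k, ‖c k‖ₑ ^ 2 * eLpNorm (X k) 2 μ ^ 2 := by
  classical
  have hS : MemLp (fun x => ∑ k, c k * X k x) 2 μ :=
    memLp_finsetSum _ fun k _ => (hX k).const_mul (c k)
  have sq (f : α → ℂ) : ((∫ x, ‖f x‖ ^ 2 ∂μ : ℝ) : ℂ) = ∫ x, f x * (starRingEnd ℂ) (f x) ∂μ := by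
    rw [← integral_complex_ofReal]
    refine integral_congr_ae (Eventually.of_forall fun x => ?_)
    simp [Complex.mul_conj, Complex.normSq_eq_norm_sq]
  have key : ∫ x, ‖∑ k, c k * X k x‖ ^ 2 ∂μ = ∑ k, ‖c k‖ ^ 2 * ∫ x, ‖X k x‖ ^ 2 ∂μ := by
    apply Complex.ofReal_injective
    rw [sq]
    have h1 : ∀ x, (∑ k, c k * X k x) * (starRingEnd ℂ) (∑ k, c k * X k x) =
        ∑ k, ∑ l, (c k * (starRingEnd ℂ) (c l)) * (X k x * (starRingEnd ℂ) (X l x)) := fun x => by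
      rw [map_sum, Finset.sum_mul_sum]
      refine Finset.sum_congr rfl fun k _ => Finset.sum_congr rfl fun l _ => ?_
      rw [map_mul]; ring
    simp_rw [h1]
    rw [integral_finsetSum _ fun k _ => integrable_finsetSum _ fun l _ =>
      (integrable_mul_conj (hX k) (hX l)).const_mul _]
    push_cast
    refine Finset.sum_congr rfl fun k _ => ?_
    rw [integral_finsetSum _ fun l _ => (integrable_mul_conj (hX k) (hX l)).const_mul _]
    simp_rw [integral_const_mul]
    rw [Finset.sum_eq_single k (fun l _ hl => by rw [orth k l hl.symm, mul_zero])
      (fun h => absurd (Finset.mem_univ k) h), ← sq]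
    simp [Complex.mul_conj, Complex.normSq_eq_norm_sq]
  rw [eLpNorm_two_sq_eq_ofReal hS, key,
    ENNReal.ofReal_sum_of_nonneg fun k _ => mul_nonneg (by positivity)
      (integral_nonneg fun x => by positivity)]
  refine Finset.sum_congr rfl fun k _ => ?_
  rw [ENNReal.ofReal_mul (by positivity), eLpNorm_two_sq_eq_ofReal (hX k),
    ENNReal.ofReal_pow (norm_nonneg _), ofReal_norm]

/-! ### Moments of Gaussian variables -/

/-- The `L^r` norm of a standard real Gaussian variable. -/
def gaussianMoment (r : ℝ≥0∞) : ℝ≥0∞ := eLpNorm id r (gaussianReal 0 1)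

theorem gaussianMoment_ne_top {r : ℝ≥0∞} (hr : r ≠ ∞) : gaussianMoment r ≠ ∞ :=
  (memLp_id_gaussianReal' r hr).2.ne

theorem eLpNorm_id_gaussianReal (v : ℝ≥0) (r : ℝ≥0∞) :
    eLpNorm id r (gaussianReal 0 v) = ENNReal.ofReal (Real.sqrt v) * gaussianMoment r := by
  have h : gaussianReal 0 v = (gaussianReal 0 1).map (fun x => Real.sqrt v * x) := by
    rw [gaussianReal_map_const_mul]
    congr 1
    · simp
    · ext; simp
  rw [h, eLpNorm_map_measure (by fun_prop) (by fun_prop)]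
  have : (id ∘ fun x => Real.sqrt v * x) = Real.sqrt v • (id : ℝ → ℝ) := by ext; simp
  rw [this, eLpNorm_const_smul, gaussianMoment, Real.enorm_eq_ofReal (Real.sqrt_nonneg _)]

theorem gaussianMoment_two : gaussianMoment 2 = 1 := by
  have h : gaussianMoment 2 ^ 2 = 1 := by
    rw [gaussianMoment, eLpNorm_two_sq_eq_ofReal (memLp_id_gaussianReal' 2 (by simp))]
    have := variance_eq_integral (X := id) (μ := gaussianReal 0 1) (by fun_prop)
    rw [variance_id_gaussianReal] at this
    simp at this
    simp [← this]
  exact (ENNReal.pow_right_strictMono two_ne_zero).injective (h.trans (one_pow 2).symm)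

/-- A centered real Gaussian is determined in law by its variance, so every `L^r` norm is a fixed
multiple of the `L²` norm. -/
theorem eLpNorm_eq_of_hasGaussianLaw_real {Ω : Type*} [MeasurableSpace Ω] {P : Measure Ω}
    {f : Ω → ℝ} (hf : HasGaussianLaw f P) (h0 : ∫ ω, f ω ∂P = 0) (r : ℝ≥0∞) :
    eLpNorm f r P = gaussianMoment r * eLpNorm f 2 P := by
  have h (r : ℝ≥0∞) : eLpNorm f r P =
      ENNReal.ofReal (Real.sqrt (Var[f; P]).toNNReal) * gaussianMoment r := by
    have h1 : eLpNorm f r P = eLpNorm id r (P.map f) := by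
      rw [eLpNorm_map_measure (by fun_prop) hf.aemeasurable]; rfl
    rw [h1, hf.map_eq_gaussianReal, h0, eLpNorm_id_gaussianReal]
  rw [h r, h 2, gaussianMoment_two, mul_one, mul_comm]

/-- No circular symmetry is assumed: real and imaginary parts are treated separately and each is
dominated in `L²` by the whole, whence the factor 2. -/
theorem eLpNorm_le_of_hasGaussianLaw {Ω : Type*} [MeasurableSpace Ω] {P : Measure Ω}
    {f : Ω → ℂ} (hf : HasGaussianLaw f P) (h0 : ∫ ω, f ω ∂P = 0) {r : ℝ≥0∞} (hr : 1 ≤ r) :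
    eLpNorm f r P ≤ 2 * gaussianMoment r * eLpNorm f 2 P := by
  have hre : HasGaussianLaw (fun ω => (f ω).re) P := hf.map_fun Complex.reCLM
  have him : HasGaussianLaw (fun ω => (f ω).im) P := hf.map_fun Complex.imCLM
  have h0re : ∫ ω, (f ω).re ∂P = 0 := by
    have := Complex.reCLM.integral_comp_comm hf.integrable
    simpa [h0] using this
  have h0im : ∫ ω, (f ω).im ∂P = 0 := by
    have := Complex.imCLM.integral_comp_comm hf.integrable
    simpa [h0] using this
  have hsplit : f = (fun ω => ((f ω).re : ℂ)) + fun ω => ((f ω).im : ℂ) * Complex.I := by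
    ext ω; simp
  have e1 (r : ℝ≥0∞) : eLpNorm (fun ω => ((f ω).re : ℂ)) r P = eLpNorm (fun ω => (f ω).re) r P :=
    eLpNorm_congr_norm_ae (Eventually.of_forall fun ω => by simp)
  have e2 (r : ℝ≥0∞) : eLpNorm (fun ω => ((f ω).im : ℂ) * Complex.I) r P =
      eLpNorm (fun ω => (f ω).im) r P :=
    eLpNorm_congr_norm_ae (Eventually.of_forall fun ω => by simp)
  calc eLpNorm f r P
      ≤ eLpNorm (fun ω => (f ω).re) r P + eLpNorm (fun ω => (f ω).im) r P := by
        conv_lhs => rw [hsplit]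
        rw [← e1, ← e2]
        refine eLpNorm_add_le ?_ ?_ hr
        · exact (Complex.measurable_ofReal.comp_aemeasurable hre.aemeasurable).aestronglyMeasurable
        · exact ((Complex.measurable_ofReal.comp_aemeasurable him.aemeasurable).mul_const
            _).aestronglyMeasurable
    _ ≤ gaussianMoment r * eLpNorm f 2 P + gaussianMoment r * eLpNorm f 2 P := by
        rw [eLpNorm_eq_of_hasGaussianLaw_real hre h0re, eLpNorm_eq_of_hasGaussianLaw_real him h0im]
        gcongr
        · exact eLpNorm_mono fun ω => by simpa using Complex.abs_re_le_norm (f ω)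
        · exact eLpNorm_mono fun ω => by simpa using Complex.abs_im_le_norm (f ω)
    _ = _ := by ring

/-! ### Mixed norms -/

theorem eLpNorm_prod_eq {α β ε : Type*} [MeasurableSpace α] [MeasurableSpace β]
    [TopologicalSpace ε] [ContinuousENorm ε] {μ : Measure α} {ν : Measure β} [SFinite μ]
    [SFinite ν] {F : α × β → ε} (hF : AEStronglyMeasurable F (μ.prod ν)) {r : ℝ≥0∞} (h0 : r ≠ 0)
    (ht : r ≠ ∞) :
    eLpNorm F r (μ.prod ν) = eLpNorm (fun y => eLpNorm (fun x => F (x, y)) r μ) r ν := by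
  have hr : r.toReal ≠ 0 := (ENNReal.toReal_pos h0 ht).ne'
  simp only [eLpNorm_eq_lintegral_rpow_enorm_toReal h0 ht, enorm_eq_self]
  rw [lintegral_prod_symm _ (hF.enorm.pow_const _)]
  congr 1
  refine lintegral_congr fun y => ?_
  rw [← ENNReal.rpow_mul, one_div, inv_mul_cancel₀ hr, ENNReal.rpow_one]

/-- Minkowski's inequality for finite sums, extended by monotone convergence along the directed
family of finite partial sums. -/
theorem eLpNorm_tsum_le {α ι : Type*} [MeasurableSpace α] [Countable ι] {μ : Measure α}
    {f : ι → α → ℝ≥0∞} (hf : ∀ i, AEMeasurable (f i) μ) {q : ℝ≥0∞} (hq : 1 ≤ q) (ht : q ≠ ∞) :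
    eLpNorm (fun x => ∑' i, f i x) q μ ≤ ∑' i, eLpNorm (f i) q μ := by
  have h0 : q ≠ 0 := (zero_lt_one.trans_le hq).ne'
  have hr : 0 < q.toReal := ENNReal.toReal_pos h0 ht
  have hfin (s : Finset ι) :
      ∫⁻ x, (∑ i ∈ s, f i x) ^ q.toReal ∂μ ≤ (∑' i, eLpNorm (f i) q μ) ^ q.toReal := by
    have h1 : eLpNorm (∑ i ∈ s, f i) q μ ≤ ∑' i, eLpNorm (f i) q μ :=
      (eLpNorm_sum_le (fun i _ => (hf i).aestronglyMeasurable) hq).trans (ENNReal.sum_le_tsum s)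
    rw [eLpNorm_eq_lintegral_rpow_enorm_toReal h0 ht, one_div, ENNReal.rpow_inv_le_iff hr] at h1
    simpa using h1
  rw [eLpNorm_eq_lintegral_rpow_enorm_toReal h0 ht, one_div, ENNReal.rpow_inv_le_iff hr]
  simp only [enorm_eq_self, ENNReal.tsum_eq_iSup_sum (f := fun i => f i _)]
  have hmono : Monotone fun t : ℝ≥0∞ => t ^ q.toReal := ENNReal.monotone_rpow_of_nonneg hr.le
  have hsup (x : α) : (⨆ s : Finset ι, ∑ i ∈ s, f i x) ^ q.toReal =
      ⨆ s : Finset ι, (∑ i ∈ s, f i x) ^ q.toReal :=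
    (ENNReal.orderIsoRpow q.toReal hr).map_iSup _
  simp_rw [hsup]
  rw [lintegral_iSup_directed]
  · exact iSup_le hfin
  · exact fun s => (Finset.aemeasurable_fun_sum s fun i _ => hf i).pow_const _
  · refine Monotone.directed_le fun s t hst x => hmono ?_
    exact Finset.sum_le_sum_of_subset hst

/-- Jensen's inequality for the average over the second variable. -/
theorem eLpNorm_integral_le {α β : Type*} [MeasurableSpace α] [MeasurableSpace β]
    {μ : Measure α} {ν : Measure β} [SFinite μ] [IsProbabilityMeasure ν] {F : α × β → ℂ}
    (hF : StronglyMeasurable F) {r : ℝ≥0∞} (h1 : 1 ≤ r) (ht : r ≠ ∞) :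
    eLpNorm (fun x => ∫ y, F (x, y) ∂ν) r μ ≤ eLpNorm F r (μ.prod ν) := by
  have h0 : r ≠ 0 := (zero_lt_one.trans_le h1).ne'
  have hswap : eLpNorm F r (μ.prod ν) = eLpNorm (F ∘ Prod.swap) r (ν.prod μ) := by
    rw [← Measure.prod_swap, eLpNorm_map_measure hF.aestronglyMeasurable (by fun_prop)]
  rw [hswap, eLpNorm_prod_eq (hF.comp_measurable measurable_swap).aestronglyMeasurable h0 ht]
  refine eLpNorm_mono_enorm fun x => ?_
  calc ‖∫ y, F (x, y) ∂ν‖ₑ ≤ ∫⁻ y, ‖F (x, y)‖ₑ ∂ν := enorm_integral_le_lintegral_enorm _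
    _ = eLpNorm (fun y => F (x, y)) 1 ν := eLpNorm_one_eq_lintegral_enorm.symm
    _ ≤ eLpNorm (fun y => F (x, y)) r ν := eLpNorm_le_eLpNorm_of_exponent_le h1
        (hF.comp_measurable measurable_prodMk_left).aestronglyMeasurable

/-! ### Quadratic forms of Gaussian vectors -/

/-- The sesquilinear form with matrix `A`. -/
def sesq {ι : Type*} [Fintype ι] (A : ι → ι → ℂ) (x y : ι → ℂ) : ℂ :=
  ∑ k, ∑ l, A k l * (x k * (starRingEnd ℂ) (y l))

/-- The squared Hilbert-Schmidt norm of the matrix `A` with weights `s`. -/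
def weightedHS {ι : Type*} [Fintype ι] (A : ι → ι → ℂ) (s : ι → ℝ≥0∞) : ℝ≥0∞ :=
  ∑ k, ∑ l, ‖A k l‖ₑ ^ 2 * (s k * s l)

section

variable {ι : Type*} [Fintype ι] (A : ι → ι → ℂ)

@[fun_prop]
theorem continuous_sesq {T : Type*} [TopologicalSpace T] {f g : T → ι → ℂ} (hf : Continuous f)
    (hg : Continuous g) : Continuous fun p => sesq A (f p) (g p) := by
  unfold sesq
  refine continuous_finsetSum _ fun k _ => continuous_finsetSum _ fun l _ =>
    continuous_const.mul (((continuous_apply k).comp hf).mul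
      (Complex.continuous_conj.comp ((continuous_apply l).comp hg)))

theorem sesq_add_left (x x' y : ι → ℂ) : sesq A (x + x') y = sesq A x y + sesq A x' y := by
  simp only [sesq, ← Finset.sum_add_distrib, Pi.add_apply]
  exact Finset.sum_congr rfl fun k _ => Finset.sum_congr rfl fun l _ => by ring

theorem sesq_add_right (x y y' : ι → ℂ) : sesq A x (y + y') = sesq A x y + sesq A x y' := by
  simp only [sesq, ← Finset.sum_add_distrib, Pi.add_apply, map_add]
  exact Finset.sum_congr rfl fun k _ => Finset.sum_congr rfl fun l _ => by ring

theorem sesq_smul_left (c : ℝ) (x y : ι → ℂ) : sesq A (c • x) y = c * sesq A x y := by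
  simp only [sesq, Finset.mul_sum, Pi.smul_apply, Complex.real_smul]
  exact Finset.sum_congr rfl fun k _ => Finset.sum_congr rfl fun l _ => by ring

theorem sesq_smul_right (c : ℝ) (x y : ι → ℂ) : sesq A x (c • y) = c * sesq A x y := by
  simp only [sesq, Finset.mul_sum, Pi.smul_apply, Complex.real_smul, map_mul, Complex.conj_ofReal]
  exact Finset.sum_congr rfl fun k _ => Finset.sum_congr rfl fun l _ => by ring

/-- Rotating by `π / 4` turns a difference of values on the diagonal into off-diagonal values. -/
theorem sesq_rotation (p : (ι → ℂ) × (ι → ℂ)) :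
    sesq A (ContinuousLinearMap.rotation (Real.pi / 4) p).1
        (ContinuousLinearMap.rotation (Real.pi / 4) p).1 -
      sesq A (ContinuousLinearMap.rotation (Real.pi / 4) p).2
        (ContinuousLinearMap.rotation (Real.pi / 4) p).2 = sesq A p.1 p.2 + sesq A p.2 p.1 := by
  -- At angle `π / 4` every product of two sines or cosines is `±1/2`; the squares cancel and the
  -- mixed terms double.
  have h2 : ((Real.sqrt 2 / 2 : ℝ) : ℂ) * ((Real.sqrt 2 / 2 : ℝ) : ℂ) = 1 / 2 := by
    rw [← Complex.ofReal_mul]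
    have : Real.sqrt 2 / 2 * (Real.sqrt 2 / 2) = 1 / 2 := by
      nlinarith [Real.mul_self_sqrt (show (0 : ℝ) ≤ 2 by norm_num)]
    rw [this]; norm_num
  simp only [ContinuousLinearMap.rotation_apply, Real.cos_pi_div_four, Real.sin_pi_div_four,
    sesq_add_left, sesq_add_right, sesq_smul_left, sesq_smul_right, Complex.ofReal_neg]
  linear_combination (2 * (sesq A p.1 p.2 + sesq A p.2 p.1)) * h2

/-- A centered Gaussian measure on `ℂ^ι` with orthogonal coordinates. -/
structure IsOrthogonalGaussian (μ : Measure (ι → ℂ)) : Prop where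
  isGaussian : IsGaussian μ
  mean : ∀ k, ∫ x, x k ∂μ = 0
  orth : ∀ k l, k ≠ l → ∫ x, x k * (starRingEnd ℂ) (x l) ∂μ = 0

variable {A} {μ : Measure (ι → ℂ)}

theorem IsOrthogonalGaussian.hasGaussianLaw_sum (h : IsOrthogonalGaussian μ) (c : ι → ℂ) :
    HasGaussianLaw (fun x : ι → ℂ => ∑ k, c k * x k) μ := by
  have := h.isGaussian
  let L : (ι → ℂ) →L[ℝ] ℂ := ∑ k, (c k) • (ContinuousLinearMap.proj (R := ℝ) (φ := fun _ => ℂ) k)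
  have := (IsGaussian.hasGaussianLaw_id (μ := μ)).map_fun L
  have hL : (fun x : ι → ℂ => ∑ k, c k * x k) = fun x => L (id x) := by
    ext x
    simp [L]
  rwa [hL]

theorem IsOrthogonalGaussian.memLp (h : IsOrthogonalGaussian μ) (k : ι) {r : ℝ≥0∞} (hr : r ≠ ∞) :
    MemLp (fun x : ι → ℂ => x k) r μ := by
  classical
  have := (h.hasGaussianLaw_sum (fun l => if l = k then 1 else 0)).memLp hr
  simpa using this

/-- Only Hermitian orthogonality enters, through Pythagoras in `L²`. The coordinates may be
dependent, as `z_k` and `z_{-k} = conj z_k` are. -/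
theorem IsOrthogonalGaussian.eLpNorm_sum_le (h : IsOrthogonalGaussian μ) (c : ι → ℂ) {r : ℝ≥0∞}
    (hr : 1 ≤ r) :
    eLpNorm (fun x : ι → ℂ => ∑ k, c k * x k) r μ ≤
      2 * gaussianMoment r *
        (∑ k, ‖c k‖ₑ ^ 2 * eLpNorm (fun x : ι → ℂ => x k) 2 μ ^ 2) ^ (1 / 2 : ℝ) := by
  have h2 : eLpNorm (fun x : ι → ℂ => ∑ k, c k * x k) 2 μ =
      (∑ k, ‖c k‖ₑ ^ 2 * eLpNorm (fun x : ι → ℂ => x k) 2 μ ^ 2) ^ (1 / 2 : ℝ) := by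
    rw [← eLpNorm_two_sq_sum_of_orthogonal (X := fun k (x : ι → ℂ) => x k)
      (fun k => h.memLp k (by simp)) h.orth c, ← ENNReal.rpow_natCast, ← ENNReal.rpow_mul]
    norm_num
  rw [← h2]
  refine eLpNorm_le_of_hasGaussianLaw (h.hasGaussianLaw_sum c) ?_ hr
  have hint (k : ι) : Integrable (fun x : ι → ℂ => x k) μ :=
    memLp_one_iff_integrable.1 (h.memLp k (by simp))
  rw [integral_finsetSum _ fun k _ => (hint k).const_mul _]
  simp [integral_const_mul, h.mean]

/-- For frozen `y` the form is a Gaussian linear form in `x` whose coefficients are conjugates of `L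
k y`, themselves Gaussian linear forms in `y`. Each of the two layers costs one factor `2 *
gaussianMoment r`. -/
theorem IsOrthogonalGaussian.eLpNorm_sesq_prod_le (h : IsOrthogonalGaussian μ)
    (A : ι → ι → ℂ) {r : ℝ≥0∞} (hr : 2 ≤ r) (ht : r ≠ ∞) :
    eLpNorm (fun p : (ι → ℂ) × (ι → ℂ) => sesq A p.1 p.2) r (μ.prod μ) ≤
      (2 * gaussianMoment r) ^ 2 *
        weightedHS A (fun k => eLpNorm (fun x : ι → ℂ => x k) 2 μ ^ 2) ^ (1 / 2 : ℝ) := by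
  have := h.isGaussian
  have hr1 : 1 ≤ r := le_trans (by norm_num) hr
  have h0 : r ≠ 0 := (zero_lt_one.trans_le hr1).ne'
  set s : ι → ℝ≥0∞ := fun k => eLpNorm (fun x : ι → ℂ => x k) 2 μ ^ 2 with hs
  set C := 2 * gaussianMoment r with hC
  have hCt : C ≠ ∞ := ENNReal.mul_ne_top (by simp) (gaussianMoment_ne_top ht)
  let L (k : ι) (y : ι → ℂ) : ℂ := ∑ l, (starRingEnd ℂ) (A k l) * y l
  have hLc (k : ι) : Continuous (L k) := by fun_prop
  have hL (k : ι) : eLpNorm (L k) r μ ≤ C * (∑ l, ‖A k l‖ₑ ^ 2 * s l) ^ (1 / 2 : ℝ) := by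
    have := h.eLpNorm_sum_le (fun l => (starRingEnd ℂ) (A k l)) hr1
    simpa [RCLike.enorm_conj] using this
  have hsesq (x y : ι → ℂ) : sesq A x y = ∑ k, (starRingEnd ℂ) (L k y) * x k := by
    simp only [sesq, L, map_sum, Finset.sum_mul, map_mul, Complex.conj_conj]
    exact Finset.sum_congr rfl fun k _ => Finset.sum_congr rfl fun l _ => by ring
  have hinner (y : ι → ℂ) : eLpNorm (fun x => sesq A x y) r μ ≤
      C * (∑ k, ‖L k y‖ₑ ^ 2 * s k) ^ (1 / 2 : ℝ) := by
    simp_rw [hsesq]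
    have := h.eLpNorm_sum_le (fun k => (starRingEnd ℂ) (L k y)) hr1
    simpa [RCLike.enorm_conj] using this
  have hhalf : r / 2 * ENNReal.ofReal 2 = r := by
    rw [show ENNReal.ofReal 2 = 2 by simp]
    exact ENNReal.div_mul_cancel (by simp) (by simp)
  have hhalf' : r * ENNReal.ofReal (1 / 2) = r / 2 := by
    rw [one_div, ENNReal.ofReal_inv_of_pos (by norm_num), show ENNReal.ofReal 2 = 2 by simp]
    rfl
  -- The assumption `2 ≤ r` serves here: the sum of the squares `‖L k y‖²` is estimated by the
  -- triangle inequality in `L^{r/2}`.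
  have hq1 : 1 ≤ r / 2 := by
    rw [ENNReal.le_div_iff_mul_le (by simp) (by simp)]; simpa using hr
  have hLsq (k : ι) : eLpNorm (fun y => ‖L k y‖ₑ ^ 2 * s k) (r / 2) μ ≤
      C ^ 2 * ((∑ l, ‖A k l‖ₑ ^ 2 * s l) * s k) := by
    have h1 : eLpNorm (fun y => ‖L k y‖ₑ ^ 2) (r / 2) μ = eLpNorm (L k) r μ ^ 2 := by
      have := eLpNorm_enorm_rpow (p := r / 2) (μ := μ) (L k) (q := 2) (by norm_num)
      rw [hhalf] at this
      simpa using this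
    have h2 : eLpNorm (fun y => ‖L k y‖ₑ ^ 2 * s k) (r / 2) μ =
        eLpNorm (fun y => ‖L k y‖ₑ ^ 2) (r / 2) μ * s k := by
      have hq0 : r / 2 ≠ 0 := (zero_lt_one.trans_le hq1).ne'
      have hqt : r / 2 ≠ ∞ := ENNReal.div_ne_top ht (by simp)
      have hp : 0 < (r / 2).toReal := ENNReal.toReal_pos hq0 hqt
      simp only [eLpNorm_eq_lintegral_rpow_enorm_toReal hq0 hqt, enorm_eq_self,
        ENNReal.mul_rpow_of_nonneg _ _ hp.le]
      rw [lintegral_mul_const _ (by fun_prop), ENNReal.mul_rpow_of_nonneg _ _ (by positivity),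
        ← ENNReal.rpow_mul, mul_one_div_cancel hp.ne', ENNReal.rpow_one]
    rw [h2, h1, ← mul_assoc]
    gcongr
    calc eLpNorm (L k) r μ ^ 2 ≤ (C * (∑ l, ‖A k l‖ₑ ^ 2 * s l) ^ (1 / 2 : ℝ)) ^ 2 := by
          gcongr; exact hL k
      _ = C ^ 2 * ∑ l, ‖A k l‖ₑ ^ 2 * s l := by
          rw [mul_pow, ← ENNReal.rpow_natCast (_ ^ (1 / 2 : ℝ)), ← ENNReal.rpow_mul]
          norm_num
  have hsum : eLpNorm (fun y => ∑ k, ‖L k y‖ₑ ^ 2 * s k) (r / 2) μ ≤ C ^ 2 * weightedHS A s := by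
    have h1 := MeasureTheory.eLpNorm_sum_le (μ := μ) (p := r / 2) (s := Finset.univ)
      (f := fun k y => ‖L k y‖ₑ ^ 2 * s k) (fun k _ =>
        (((hLc k).measurable.enorm.pow_const 2).mul_const _).aestronglyMeasurable) hq1
    have h2 : (∑ k, fun y => ‖L k y‖ₑ ^ 2 * s k) = fun y => ∑ k, ‖L k y‖ₑ ^ 2 * s k := by
      ext y; simp
    rw [h2] at h1
    refine h1.trans ((Finset.sum_le_sum fun k _ => hLsq k).trans_eq ?_)
    rw [weightedHS, Finset.mul_sum]
    refine Finset.sum_congr rfl fun k _ => ?_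
    rw [Finset.sum_mul]
    congr 1
    exact Finset.sum_congr rfl fun l _ => by ring
  rw [eLpNorm_prod_eq (by
    have : Continuous fun p : (ι → ℂ) × (ι → ℂ) => sesq A p.1 p.2 := by fun_prop
    exact this.aestronglyMeasurable) h0 ht]
  calc eLpNorm (fun y => eLpNorm (fun x => sesq A x y) r μ) r μ
      ≤ eLpNorm (fun y => C * (∑ k, ‖L k y‖ₑ ^ 2 * s k) ^ (1 / 2 : ℝ)) r μ :=
        eLpNorm_mono_enorm fun y => hinner y
    _ = C * eLpNorm (fun y => (∑ k, ‖L k y‖ₑ ^ 2 * s k) ^ (1 / 2 : ℝ)) r μ := by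
        have hp : 0 < r.toReal := ENNReal.toReal_pos h0 ht
        simp only [eLpNorm_eq_lintegral_rpow_enorm_toReal h0 ht, enorm_eq_self,
          ENNReal.mul_rpow_of_nonneg _ _ hp.le]
        rw [lintegral_const_mul _ (by fun_prop), ENNReal.mul_rpow_of_nonneg _ _ (by positivity),
          ← ENNReal.rpow_mul, mul_one_div_cancel hp.ne', ENNReal.rpow_one]
    _ = C * eLpNorm (fun y => ∑ k, ‖L k y‖ₑ ^ 2 * s k) (r / 2) μ ^ (1 / 2 : ℝ) := by
        have := eLpNorm_enorm_rpow (p := r) (μ := μ) (fun y => ∑ k, ‖L k y‖ₑ ^ 2 * s k)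
          (q := 1 / 2) (by norm_num)
        rw [hhalf'] at this
        rw [← this]
        simp only [enorm_eq_self]
    _ ≤ C * (C ^ 2 * weightedHS A s) ^ (1 / 2 : ℝ) := by gcongr
    _ = C ^ 2 * weightedHS A s ^ (1 / 2 : ℝ) := by
        rw [ENNReal.mul_rpow_of_nonneg _ _ (by norm_num), ← ENNReal.rpow_natCast,
          ← ENNReal.rpow_mul, ← mul_assoc]
        norm_num [pow_two]

/-- Equivalence of moments for off-diagonal quadratic forms of Gaussian vectors, by decoupling. -/
theorem IsOrthogonalGaussian.eLpNorm_sesq_self_le (h : IsOrthogonalGaussian μ)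
    {A : ι → ι → ℂ} (hA : ∀ k, A k k = 0) {r : ℝ≥0∞} (hr : 2 ≤ r) (ht : r ≠ ∞) :
    eLpNorm (fun x : ι → ℂ => sesq A x x) r μ ≤
      2 * (2 * gaussianMoment r) ^ 2 *
        weightedHS A (fun k => eLpNorm (fun x : ι → ℂ => x k) 2 μ ^ 2) ^ (1 / 2 : ℝ) := by
  have := h.isGaussian
  have hr1 : 1 ≤ r := le_trans (by norm_num) hr
  have hint (k l : ι) : Integrable (fun x : ι → ℂ => x k * (starRingEnd ℂ) (x l)) μ :=
    integrable_mul_conj (h.memLp k (by simp)) (h.memLp l (by simp))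
  have hintQ : Integrable (fun x : ι → ℂ => sesq A x x) μ :=
    integrable_finsetSum _ fun k _ => integrable_finsetSum _ fun l _ => (hint k l).const_mul _
  -- Off-diagonal terms vanish by orthogonality, diagonal ones by `hA`.
  have hmean : ∫ x, sesq A x x ∂μ = 0 := by
    unfold sesq
    rw [integral_finsetSum _ fun k _ => integrable_finsetSum _ fun l _ => (hint k l).const_mul _]
    refine Finset.sum_eq_zero fun k _ => ?_
    rw [integral_finsetSum _ fun l _ => (hint k l).const_mul _]
    refine Finset.sum_eq_zero fun l _ => ?_
    rw [integral_const_mul]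
    by_cases hkl : k = l
    · rw [← hkl, hA, zero_mul]
    · rw [h.orth k l hkl, mul_zero]
  -- Mean zero lets the form be written as an average over an independent copy, ready for Jensen's
  -- inequality.
  have hcent (x : ι → ℂ) : ∫ y, (sesq A x x - sesq A y y) ∂μ = sesq A x x := by
    rw [integral_sub (integrable_const _) hintQ, hmean]; simp
  have hzero : ∫ x, id x ∂μ = 0 := by
    ext k
    have := (ContinuousLinearMap.proj (R := ℝ) (φ := fun _ : ι => ℂ) k).integral_comp_comm
      (IsGaussian.integrable_id (μ := μ))
    simpa [h.mean k] using this.symm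
  have hrot := IsGaussian.map_rotation_eq_self (μ := μ) hzero (Real.pi / 4)
  have hcD : Continuous fun p : (ι → ℂ) × (ι → ℂ) => sesq A p.1 p.1 - sesq A p.2 p.2 := by fun_prop
  have hc1 : Continuous fun p : (ι → ℂ) × (ι → ℂ) => sesq A p.1 p.2 := by fun_prop
  have hc2 : Continuous fun p : (ι → ℂ) × (ι → ℂ) => sesq A p.2 p.1 := by fun_prop
  calc eLpNorm (fun x : ι → ℂ => sesq A x x) r μ
      = eLpNorm (fun x : ι → ℂ => ∫ y, (sesq A x x - sesq A y y) ∂μ) r μ := by simp_rw [hcent]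
    _ ≤ eLpNorm (fun p : (ι → ℂ) × (ι → ℂ) => sesq A p.1 p.1 - sesq A p.2 p.2) r (μ.prod μ) :=
        eLpNorm_integral_le (F := fun p : (ι → ℂ) × (ι → ℂ) => sesq A p.1 p.1 - sesq A p.2 p.2)
          hcD.stronglyMeasurable hr1 ht
    _ = eLpNorm ((fun p : (ι → ℂ) × (ι → ℂ) => sesq A p.1 p.2) + fun p => sesq A p.2 p.1) r
          (μ.prod μ) := by
        conv_lhs => rw [← hrot]
        rw [eLpNorm_map_measure hcD.aestronglyMeasurable (by fun_prop)]
        congr 1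
        ext p
        exact sesq_rotation A p
    _ ≤ eLpNorm (fun p : (ι → ℂ) × (ι → ℂ) => sesq A p.1 p.2) r (μ.prod μ) +
          eLpNorm (fun p : (ι → ℂ) × (ι → ℂ) => sesq A p.2 p.1) r (μ.prod μ) :=
        eLpNorm_add_le hc1.aestronglyMeasurable hc2.aestronglyMeasurable hr1
    _ = 2 * eLpNorm (fun p : (ι → ℂ) × (ι → ℂ) => sesq A p.1 p.2) r (μ.prod μ) := by
        have : eLpNorm (fun p : (ι → ℂ) × (ι → ℂ) => sesq A p.2 p.1) r (μ.prod μ) =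
            eLpNorm (fun p : (ι → ℂ) × (ι → ℂ) => sesq A p.1 p.2) r (μ.prod μ) := by
          conv_rhs => rw [← Measure.prod_swap]
          rw [eLpNorm_map_measure hc1.aestronglyMeasurable (by fun_prop)]
          rfl
        rw [this, two_mul]
    _ ≤ _ := by
        rw [mul_assoc]
        gcongr
        exact h.eLpNorm_sesq_prod_le A hr ht

end

/-! ### The Gaussian structure of the noise -/

/-- A finite set of pairs is enlarged to a rectangle `J × K`, where independence across `J` gives a
joint Gaussian law; the original set is then a linear projection. -/
theorem isGaussianProcess_of_iIndepFun {Ω S T : Type*} [MeasurableSpace Ω] {P : Measure Ω}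
    {B : S → T → Ω → ℝ} (hB : ∀ i, IsGaussianProcess (B i) P)
    (hind : iIndepFun (fun i ω t => B i t ω) P) :
    IsGaussianProcess (fun (p : S × T) => B p.1 p.2) P where
  hasGaussianLaw I := by
    classical
    let J := I.image Prod.fst
    let K := I.image Prod.snd
    have h1 : iIndepFun (fun (i : J) ω (t : K) => B i t ω) P :=
      (hind.precomp (g := fun i : J => (i : S)) Subtype.val_injective).comp
        (fun _ f (t : K) => f t) fun _ => by fun_prop
    have h2 : HasGaussianLaw (fun ω (i : J) (t : K) => B i t ω) P :=
      h1.hasGaussianLaw fun i => (hB i).hasGaussianLaw K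
    let L : (J → K → ℝ) →L[ℝ] (I → ℝ) :=
      { toFun x p := x ⟨p.1.1, Finset.mem_image_of_mem _ p.2⟩ ⟨p.1.2, Finset.mem_image_of_mem _ p.2⟩
        map_add' x y := by ext; simp
        map_smul' c x := by ext; simp }
    exact h2.map_fun L

/-! ### Modes and their representatives in the half-lattice; covariances of the noise. -/

theorem Mode.opp_opp (k : Mode) : k.opp.opp = k := Subtype.ext (neg_neg k.1)

theorem Mode.isPositive_or_opp (k : Mode) : k.IsPositive ∨ k.opp.IsPositive := by
  have hk : k.1 0 ≠ 0 ∨ k.1 1 ≠ 0 := by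
    by_contra! h
    exact k.2 (funext fun j => by fin_cases j <;> simp [h.1, h.2])
  simp only [Mode.IsPositive, Mode.opp, Pi.neg_apply]
  omega

/-- The mode in the positive half-lattice that equals `k` or `-k`. -/
def Mode.pos (k : Mode) : {k : Mode // k.IsPositive} :=
  open Classical in
  if h : k.IsPositive then ⟨k, h⟩ else ⟨k.opp, k.isPositive_or_opp.resolve_left h⟩

/-- The sign relating a mode to its positive representative. -/
def Mode.sgn (k : Mode) : ℝ := open Classical in if k.IsPositive then 1 else -1

theorem Mode.sgn_mul_self (k : Mode) : k.sgn * k.sgn = 1 := by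
  unfold Mode.sgn; split_ifs <;> norm_num

/-- Two distinct modes with the same representative are opposite. This sign makes `β_k` and `β_{-k}`
orthogonal although they are dependent. -/
theorem Mode.sgn_mul_of_ne {k l : Mode} (hkl : k ≠ l) (h : k.pos = l.pos) :
    k.sgn * l.sgn = -1 := by
  unfold Mode.sgn
  unfold Mode.pos at h
  by_cases hk : k.IsPositive <;> by_cases hl : l.IsPositive <;> simp [hk, hl] at h ⊢
  · exact absurd h hkl
  · exact absurd (by rw [← k.opp_opp, h, l.opp_opp]) hkl

/-- The real and imaginary parts of the components of the noise. -/
def noisePart {Ω : Type*} (β : Mode → ℝ≥0 → Ω → ℂ) (i : {k : Mode // k.IsPositive} × Bool)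
    (t : ℝ≥0) (ω : Ω) : ℝ :=
  if i.2 then (β i.1.1 t ω).re else (β i.1.1 t ω).im

theorem noisePart_eq {Ω : Type*} (β : Mode → ℝ≥0 → Ω → ℂ)
    (i : {k : Mode // k.IsPositive} × Bool) (t : ℝ≥0) (ω : Ω) :
    noisePart β i t ω = (Real.sqrt 2)⁻¹ * (Real.sqrt 2 * noisePart β i t ω) := by
  rw [inv_mul_cancel_left₀ (by positivity)]

section

variable {Ω : Type*} [MeasurableSpace Ω] {P : Measure Ω} {β : Mode → ℝ≥0 → Ω → ℂ}

theorem IsCylindricalWiener.isPreBrownianReal (h : IsCylindricalWiener P β)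
    (i : {k : Mode // k.IsPositive} × Bool) :
    IsPreBrownianReal (fun t ω => Real.sqrt 2 * noisePart β i t ω) P := by
  obtain ⟨k, b⟩ := i
  cases b
  · exact (h.brownian_im k.1 k.2).toIsPreBrownianReal
  · exact (h.brownian_re k.1 k.2).toIsPreBrownianReal

theorem IsCylindricalWiener.jointlyGaussian_noisePart (h : IsCylindricalWiener P β) :
    IsGaussianProcess (fun p : ({k : Mode // k.IsPositive} × Bool) × ℝ≥0 =>
      noisePart β p.1 p.2) P := by
  refine isGaussianProcess_of_iIndepFun (fun i => ?_) h.indep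
  have := (IsPreBrownianReal.isGaussianProcess (h.isPreBrownianReal i)).smul
    fun _ => (Real.sqrt 2)⁻¹
  exact this.congr fun t => Eventually.of_forall fun ω => (noisePart_eq β i t ω).symm

theorem IsCylindricalWiener.memLp_noisePart (h : IsCylindricalWiener P β)
    (i : {k : Mode // k.IsPositive} × Bool) (t : ℝ≥0) : MemLp (noisePart β i t) 2 P :=
  (h.jointlyGaussian_noisePart.hasGaussianLaw_eval (i, t)).memLp_two

theorem IsCylindricalWiener.integral_noisePart (h : IsCylindricalWiener P β)
    (i : {k : Mode // k.IsPositive} × Bool) (t : ℝ≥0) : ∫ ω, noisePart β i t ω ∂P = 0 := by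
  rw [integral_congr_ae (Eventually.of_forall (noisePart_eq β i t)), integral_const_mul,
    (h.isPreBrownianReal i).integral_eval, mul_zero]

theorem IsCylindricalWiener.integral_noisePart_mul (h : IsCylindricalWiener P β)
    (i j : {k : Mode // k.IsPositive} × Bool) (s t : ℝ≥0) :
    ∫ ω, noisePart β i s ω * noisePart β j t ω ∂P =
      open Classical in if i = j then ((min s t : ℝ≥0) : ℝ) / 2 else 0 := by
  have := h.jointlyGaussian_noisePart.isProbabilityMeasure
  split_ifs with hij
  · subst hij
    have hc := (h.isPreBrownianReal i).covariance_fun_eval s t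
    rw [covariance_const_mul_left, covariance_const_mul_right, covariance_eq_sub
      (h.memLp_noisePart i s) (h.memLp_noisePart i t), h.integral_noisePart, zero_mul,
      sub_zero, ← mul_assoc, Real.mul_self_sqrt (by norm_num)] at hc
    simp only [Pi.mul_apply] at hc
    linarith
  · have hind : IndepFun (noisePart β i s) (noisePart β j t) P :=
      (h.indep.indepFun hij).comp (φ := fun f : ℝ≥0 → ℝ => f s) (ψ := fun f : ℝ≥0 → ℝ => f t)
        (measurable_pi_apply s) (measurable_pi_apply t)
    rw [hind.integral_fun_mul_eq_mul_integral (h.memLp_noisePart i s).aestronglyMeasurable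
      (h.memLp_noisePart j t).aestronglyMeasurable, h.integral_noisePart, zero_mul]

/-- The representation of a component of the noise through real Gaussian processes. -/
def noiseRep {Ω : Type*} (β : Mode → ℝ≥0 → Ω → ℂ) (k : Mode) (t : ℝ≥0) (ω : Ω) : ℂ :=
  noisePart β (k.pos, true) t ω + k.sgn * Complex.I * noisePart β (k.pos, false) t ω

theorem IsCylindricalWiener.noiseRep_ae_eq (h : IsCylindricalWiener P β) (k : Mode) (t : ℝ≥0) :
    noiseRep β k t =ᵐ[P] β k t := by
  by_cases hk : k.IsPositive
  · refine Eventually.of_forall fun ω => ?_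
    simp [noiseRep, noisePart, Mode.pos, Mode.sgn, hk, mul_comm Complex.I]
  · filter_upwards [h.conj_symm k.opp t] with ω hω
    rw [k.opp_opp] at hω
    rw [hω]
    apply Complex.ext <;> simp [noiseRep, noisePart, Mode.pos, Mode.sgn, hk]

/-- Independence is only given on the half-lattice, but up to null sets each component is a
real-linear combination of two noise parts, so Gaussianity holds jointly over all modes and times.
-/
theorem IsCylindricalWiener.jointlyGaussian (h : IsCylindricalWiener P β) :
    IsGaussianProcess (fun p : Mode × ℝ≥0 => β p.1 p.2) P := by
  classical
  refine IsGaussianProcess.congr (X := fun p : Mode × ℝ≥0 => noiseRep β p.1 p.2) ?_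
    fun p => h.noiseRep_ae_eq p.1 p.2
  refine IsGaussianProcess.of_isGaussianProcess h.jointlyGaussian_noisePart fun p => ?_
  let a : ({k : Mode // k.IsPositive} × Bool) × ℝ≥0 := ((p.1.pos, true), p.2)
  let b : ({k : Mode // k.IsPositive} × Bool) × ℝ≥0 := ((p.1.pos, false), p.2)
  let I : Finset (({k : Mode // k.IsPositive} × Bool) × ℝ≥0) := {a, b}
  let pa : (I → ℝ) →L[ℝ] ℝ := ContinuousLinearMap.proj (⟨a, by simp [I]⟩ : I)
  let pb : (I → ℝ) →L[ℝ] ℝ := ContinuousLinearMap.proj (⟨b, by simp [I]⟩ : I)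
  refine ⟨I, pa.smulRight (1 : ℂ) + pb.smulRight ((p.1.sgn : ℂ) * Complex.I), fun ω => ?_⟩
  simp [noiseRep, pa, pb, a, b, mul_comm]

theorem IsCylindricalWiener.memLp (h : IsCylindricalWiener P β) (k : Mode) (t : ℝ≥0) :
    MemLp (β k t) 2 P :=
  (h.jointlyGaussian.hasGaussianLaw_eval (k, t)).memLp_two

theorem IsCylindricalWiener.integral_eq_zero (h : IsCylindricalWiener P β) (k : Mode) (t : ℝ≥0) :
    ∫ ω, β k t ω ∂P = 0 := by
  have := h.jointlyGaussian.isProbabilityMeasure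
  have hi (b : Bool) : Integrable (fun ω => (noisePart β (k.pos, b) t ω : ℂ)) P :=
    ((h.memLp_noisePart (k.pos, b) t).integrable (by norm_num)).ofReal
  rw [← integral_congr_ae (h.noiseRep_ae_eq k t)]
  unfold noiseRep
  rw [integral_add (hi _) ((hi _).const_mul _), integral_const_mul, integral_complex_ofReal,
    integral_complex_ofReal, h.integral_noisePart, h.integral_noisePart]
  simp

/-- Mixed real-imaginary products have mean zero. When the representatives agree, the rest is `(1 +
k.sgn * l.sgn) / 2` times `min s t`, so opposite modes cancel exactly. -/
theorem IsCylindricalWiener.integral_mul_conj (h : IsCylindricalWiener P β) (k l : Mode)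
    (s t : ℝ≥0) :
    ∫ ω, β k s ω * (starRingEnd ℂ) (β l t ω) ∂P =
      open Classical in if k = l then ((min s t : ℝ≥0) : ℂ) else 0 := by
  classical
  have := h.jointlyGaussian.isProbabilityMeasure
  have hae : (fun ω => β k s ω * (starRingEnd ℂ) (β l t ω)) =ᵐ[P]
      fun ω => (((noisePart β (k.pos, true) s ω * noisePart β (l.pos, true) t ω : ℝ) : ℂ) +
        (k.sgn * l.sgn : ℂ) *
          ((noisePart β (k.pos, false) s ω * noisePart β (l.pos, false) t ω : ℝ) : ℂ)) +
        ((k.sgn * Complex.I) *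
          ((noisePart β (k.pos, false) s ω * noisePart β (l.pos, true) t ω : ℝ) : ℂ) +
        (-l.sgn * Complex.I) *
          ((noisePart β (k.pos, true) s ω * noisePart β (l.pos, false) t ω : ℝ) : ℂ)) := by
    filter_upwards [h.noiseRep_ae_eq k s, h.noiseRep_ae_eq l t] with ω h1 h2
    rw [← h1, ← h2]
    simp only [noiseRep, map_add, map_mul, Complex.conj_ofReal, Complex.conj_I]
    push_cast
    linear_combination (-(k.sgn * l.sgn : ℂ) * noisePart β (k.pos, false) s ω *
      noisePart β (l.pos, false) t ω) * Complex.I_mul_I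
  have hi (b c : Bool) : Integrable
      (fun ω => ((noisePart β (k.pos, b) s ω * noisePart β (l.pos, c) t ω : ℝ) : ℂ)) P :=
    ((h.memLp_noisePart (k.pos, b) s).integrable_mul (q := 2)
      (h.memLp_noisePart (l.pos, c) t)).ofReal
  rw [integral_congr_ae hae]
  refine (integral_add ((hi _ _).add ((hi _ _).const_mul _))
    (((hi _ _).const_mul _).add ((hi _ _).const_mul _))).trans ?_
  simp only [Pi.add_apply]
  rw [integral_add (hi _ _) ((hi _ _).const_mul _),
    integral_add ((hi _ _).const_mul _) ((hi _ _).const_mul _)]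
  simp only [integral_const_mul, integral_complex_ofReal, h.integral_noisePart_mul, Prod.mk.injEq,
    and_true, reduceCtorEq, and_false, if_false]
  by_cases hkl : k = l
  · subst hkl
    have := congrArg (fun x : ℝ => (x : ℂ)) k.sgn_mul_self
    push_cast at this
    simp [this]
  · by_cases hp : k.pos = l.pos
    · have := congrArg (fun x : ℝ => (x : ℂ)) (Mode.sgn_mul_of_ne hkl hp)
      push_cast at this
      simp [this, hp, hkl]
    · simp [hp, hkl]

end

/-! ### Integrals of elementary functions -/

/-- The length of the intersection of two intervals. -/
def overlap (a b c d : ℝ) : ℝ := volume.real (Set.Ioc a b ∩ Set.Ioc c d)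

/-- The right-hand side is the covariance of two Brownian increments expanded through `min`; this
identity is the source of the Itô isometry. -/
theorem overlap_eq {a b c d : ℝ} (hab : a ≤ b) (hcd : c ≤ d) :
    overlap a b c d = min b d - min b c - min a d + min a c := by
  rw [overlap, Set.Ioc_inter_Ioc, Real.volume_real_Ioc]
  grind

theorem indicator_one_mul_indicator_one (S T : Set ℝ) :
    (fun s => S.indicator (fun _ => (1 : ℝ)) s * T.indicator (fun _ => (1 : ℝ)) s) =
      (S ∩ T).indicator fun _ => (1 : ℝ) := by
  ext s
  by_cases hS : s ∈ S <;> by_cases hT : s ∈ T <;> simp [hS, hT]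

theorem integrable_indicator_mul (a b c d t : ℝ) :
    Integrable (fun s => (Set.Ioc a b).indicator (fun _ => (1 : ℝ)) s *
      (Set.Ioc c d).indicator (fun _ => (1 : ℝ)) s) (volume.restrict (Set.Ioc 0 t)) := by
  rw [indicator_one_mul_indicator_one]
  exact (integrable_const _).indicator (measurableSet_Ioc.inter measurableSet_Ioc)

theorem integral_indicator_mul_indicator {a b c d t : ℝ} (ha : 0 ≤ a) (hb : b ≤ t) :
    ∫ s in Set.Ioc 0 t, (Set.Ioc a b).indicator (fun _ => (1 : ℝ)) s *
      (Set.Ioc c d).indicator (fun _ => (1 : ℝ)) s = overlap a b c d := by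
  rw [indicator_one_mul_indicator_one,
    integral_indicator (measurableSet_Ioc.inter measurableSet_Ioc),
    Measure.restrict_restrict (measurableSet_Ioc.inter measurableSet_Ioc), overlap]
  have hsub : Set.Ioc a b ∩ Set.Ioc c d ∩ Set.Ioc 0 t = Set.Ioc a b ∩ Set.Ioc c d := by
    refine Set.inter_eq_left.2 fun x hx => ⟨ha.trans_lt hx.1.1, hx.1.2.trans hb⟩
  rw [hsub]
  simp

/-- The integral of a product of two elementary functions, as a double sum. -/
def ElementaryFunction.pairing (φ ψ : ElementaryFunction) : ℝ :=
  ∑ i ∈ Finset.range φ.m, ∑ j ∈ Finset.range ψ.m,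
    φ.a i * ψ.a j * overlap (φ.τ i) (φ.τ (i + 1)) (ψ.τ j) (ψ.τ (j + 1))

theorem ElementaryFunction.value_eq (φ : ElementaryFunction) (s : ℝ) :
    φ.value s = ∑ i ∈ Finset.range φ.m,
      φ.a i * (Set.Ioc (φ.τ i : ℝ) (φ.τ (i + 1) : ℝ)).indicator (fun _ => (1 : ℝ)) s := by
  refine Finset.sum_congr rfl fun i _ => ?_
  by_cases h : s ∈ Set.Ioc (φ.τ i : ℝ) (φ.τ (i + 1) : ℝ) <;> simp [h]

theorem ElementaryFunction.integral_value_sq (φ : ElementaryFunction) {t : ℝ≥0}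
    (ht : ∀ i, φ.τ i ≤ t) :
    ∫ s in Set.Ioc (0 : ℝ) t, φ.value s ^ 2 = φ.pairing φ := by
  have h1 (s : ℝ) : φ.value s ^ 2 = ∑ i ∈ Finset.range φ.m, ∑ j ∈ Finset.range φ.m,
      φ.a i * φ.a j * ((Set.Ioc (φ.τ i : ℝ) (φ.τ (i + 1) : ℝ)).indicator (fun _ => (1 : ℝ)) s *
        (Set.Ioc (φ.τ j : ℝ) (φ.τ (j + 1) : ℝ)).indicator (fun _ => (1 : ℝ)) s) := by
    rw [φ.value_eq, pow_two, Finset.sum_mul_sum]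
    exact Finset.sum_congr rfl fun i _ => Finset.sum_congr rfl fun j _ => by ring
  simp_rw [h1]
  rw [integral_finsetSum _ fun i _ => integrable_finsetSum _ fun j _ =>
    (integrable_indicator_mul _ _ _ _ _).const_mul _]
  refine Finset.sum_congr rfl fun i _ => ?_
  rw [integral_finsetSum _ fun j _ => (integrable_indicator_mul _ _ _ _ _).const_mul _]
  refine Finset.sum_congr rfl fun j _ => ?_
  rw [integral_const_mul,
    integral_indicator_mul_indicator (φ.τ i).coe_nonneg (by exact_mod_cast ht (i + 1))]

theorem ElementaryFunction.memLp_value (φ : ElementaryFunction) (t : ℝ) :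
    MemLp φ.value 2 (volume.restrict (Set.Ioc 0 t)) := by
  unfold ElementaryFunction.value
  exact memLp_finsetSum _ fun i _ => (memLp_const _).indicator measurableSet_Ioc

/-! ### Elementary integrals against the noise: covariances, isometry and joint law. -/

section

variable {Ω : Type*} [MeasurableSpace Ω] {P : Measure Ω} {β : Mode → ℝ≥0 → Ω → ℂ}

theorem IsCylindricalWiener.integral_increment_mul_conj (h : IsCylindricalWiener P β) (k l : Mode)
    {a b c d : ℝ≥0} (hab : a ≤ b) (hcd : c ≤ d) :
    ∫ ω, (β k b ω - β k a ω) * (starRingEnd ℂ) (β l d ω - β l c ω) ∂P =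
      open Classical in if k = l then (overlap a b c d : ℂ) else 0 := by
  have hi (s t : ℝ≥0) : Integrable (fun ω => β k s ω * (starRingEnd ℂ) (β l t ω)) P :=
    integrable_mul_conj (h.memLp k s) (h.memLp l t)
  have hexp : (fun ω => (β k b ω - β k a ω) * (starRingEnd ℂ) (β l d ω - β l c ω)) =
      fun ω => (β k b ω * (starRingEnd ℂ) (β l d ω) - β k b ω * (starRingEnd ℂ) (β l c ω)) -
        (β k a ω * (starRingEnd ℂ) (β l d ω) - β k a ω * (starRingEnd ℂ) (β l c ω)) := by
    ext ω; rw [map_sub]; ring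
  rw [hexp]
  refine (integral_sub ((hi _ _).sub (hi _ _)) ((hi _ _).sub (hi _ _))).trans ?_
  simp only [Pi.sub_apply]
  rw [integral_sub (hi _ _) (hi _ _), integral_sub (hi _ _) (hi _ _)]
  simp only [h.integral_mul_conj]
  split_ifs with hkl
  · rw [overlap_eq (by exact_mod_cast hab) (by exact_mod_cast hcd)]
    norm_cast
    push_cast
    ring
  · simp

theorem IsCylindricalWiener.memLp_integral (h : IsCylindricalWiener P β) (k : Mode)
    (φ : ElementaryFunction) : MemLp (φ.integral (β k)) 2 P := by
  unfold ElementaryFunction.integral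
  exact memLp_finsetSum _ fun i _ => ((h.memLp k _).sub (h.memLp k _)).const_mul _

theorem IsCylindricalWiener.integral_integral_mul_conj (h : IsCylindricalWiener P β) (k l : Mode)
    (φ ψ : ElementaryFunction) :
    ∫ ω, φ.integral (β k) ω * (starRingEnd ℂ) (ψ.integral (β l) ω) ∂P =
      open Classical in if k = l then (φ.pairing ψ : ℂ) else 0 := by
  have hi (i j : ℕ) : Integrable (fun ω => (β k (φ.τ (i + 1)) ω - β k (φ.τ i) ω) *
      (starRingEnd ℂ) (β l (ψ.τ (j + 1)) ω - β l (ψ.τ j) ω)) P :=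
    integrable_mul_conj ((h.memLp k _).sub (h.memLp k _)) ((h.memLp l _).sub (h.memLp l _))
  have hexp (ω : Ω) : φ.integral (β k) ω * (starRingEnd ℂ) (ψ.integral (β l) ω) =
      ∑ i ∈ Finset.range φ.m, ∑ j ∈ Finset.range ψ.m, ((φ.a i : ℂ) * (ψ.a j : ℂ)) *
        ((β k (φ.τ (i + 1)) ω - β k (φ.τ i) ω) *
          (starRingEnd ℂ) (β l (ψ.τ (j + 1)) ω - β l (ψ.τ j) ω)) := by
    unfold ElementaryFunction.integral
    rw [map_sum, Finset.sum_mul_sum]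
    refine Finset.sum_congr rfl fun i _ => Finset.sum_congr rfl fun j _ => ?_
    rw [map_mul, Complex.conj_ofReal]; ring
  simp_rw [hexp]
  rw [integral_finsetSum _ fun i _ => integrable_finsetSum _ fun j _ => (hi i j).const_mul _]
  have hterm (i : ℕ) : ∫ ω, ∑ j ∈ Finset.range ψ.m, ((φ.a i : ℂ) * (ψ.a j : ℂ)) *
        ((β k (φ.τ (i + 1)) ω - β k (φ.τ i) ω) *
          (starRingEnd ℂ) (β l (ψ.τ (j + 1)) ω - β l (ψ.τ j) ω)) ∂P =
      ∑ j ∈ Finset.range ψ.m, ((φ.a i : ℂ) * (ψ.a j : ℂ)) * (open Classical in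
        if k = l then (overlap (φ.τ i) (φ.τ (i + 1)) (ψ.τ j) (ψ.τ (j + 1)) : ℂ) else 0) := by
    rw [integral_finsetSum _ fun j _ => (hi i j).const_mul _]
    refine Finset.sum_congr rfl fun j _ => ?_
    rw [integral_const_mul, h.integral_increment_mul_conj k l (φ.mono i.le_succ)
      (ψ.mono j.le_succ)]
  simp_rw [hterm]
  split_ifs with hkl
  · rw [ElementaryFunction.pairing]
    push_cast
    rfl
  · simp

theorem IsCylindricalWiener.integral_integral_eq_zero (h : IsCylindricalWiener P β) (k : Mode)
    (φ : ElementaryFunction) : ∫ ω, φ.integral (β k) ω ∂P = 0 := by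
  have := h.jointlyGaussian.isProbabilityMeasure
  have hi (t : ℝ≥0) : Integrable (β k t) P := (h.memLp k t).integrable (by norm_num)
  unfold ElementaryFunction.integral
  refine (integral_finsetSum _ fun i _ => ((hi _).sub (hi _)).const_mul _).trans ?_
  refine Finset.sum_eq_zero fun i _ => ?_
  refine (integral_const_mul _ _).trans ?_
  simp only [Pi.sub_apply]
  rw [integral_sub (hi _) (hi _), h.integral_eq_zero, h.integral_eq_zero,
    sub_zero, mul_zero]

/-- The Itô isometry for elementary functions. -/
theorem IsCylindricalWiener.eLpNorm_integral (h : IsCylindricalWiener P β) (k : Mode)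
    (φ : ElementaryFunction) {t : ℝ≥0} (ht : ∀ i, φ.τ i ≤ t) :
    eLpNorm (φ.integral (β k)) 2 P =
      eLpNorm φ.value 2 (volume.restrict (Set.Ioc (0 : ℝ) (t : ℝ))) := by
  apply (ENNReal.pow_right_strictMono two_ne_zero).injective
  simp only
  rw [eLpNorm_two_sq_eq_ofReal (h.memLp_integral k φ), eLpNorm_two_sq_eq_ofReal (φ.memLp_value t)]
  congr 1
  simp only [Real.norm_eq_abs, sq_abs, φ.integral_value_sq ht]
  apply Complex.ofReal_injective
  have := h.integral_integral_mul_conj k k φ φ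
  rw [if_pos rfl] at this
  rw [← this, ← integral_complex_ofReal]
  refine integral_congr_ae (Eventually.of_forall fun ω => ?_)
  simp [Complex.mul_conj, Complex.normSq_eq_norm_sq]

theorem IsCylindricalWiener.hasGaussianLaw_integral (h : IsCylindricalWiener P β)
    (φ : Mode → ElementaryFunction) (Λ : Finset Mode) :
    HasGaussianLaw (fun ω (k : Λ) => (φ k).integral (β k) ω) P := by
  classical
  have key : IsGaussianProcess (fun (k : Mode) ω => (φ k).integral (β k) ω) P := by
    refine IsGaussianProcess.of_isGaussianProcess h.jointlyGaussian fun k => ?_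
    let I : Finset (Mode × ℝ≥0) :=
      (Finset.range ((φ k).m + 1)).image fun i => (k, (φ k).τ i)
    -- The value 0 only makes `pr` total: the sum uses indices `i` and `i + 1` with `i < m`, both
    -- below `m + 1`.
    let pr (i : ℕ) : (I → ℂ) →L[ℝ] ℂ :=
      if hi : i < (φ k).m + 1 then ContinuousLinearMap.proj (⟨(k, (φ k).τ i),
        Finset.mem_image.2 ⟨i, Finset.mem_range.2 hi, rfl⟩⟩ : I) else 0
    refine ⟨I, ∑ i ∈ Finset.range (φ k).m, (φ k).a i • (pr (i + 1) - pr i), fun ω => ?_⟩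
    rw [sum_apply]
    refine Finset.sum_congr rfl fun i hi => ?_
    have hi' := Finset.mem_range.1 hi
    simp [pr, hi', hi'.le]
  exact key.hasGaussianLaw Λ

/-- The joint law of finitely many elementary integrals. -/
theorem IsCylindricalWiener.isOrthogonalGaussian (h : IsCylindricalWiener P β)
    (φ : Mode → ElementaryFunction) (Λ : Finset Mode) :
    IsOrthogonalGaussian (P.map fun ω (k : Λ) => (φ k).integral (β k) ω) where
  isGaussian := (h.hasGaussianLaw_integral φ Λ).isGaussian_map
  mean k := by
    rw [integral_map (h.hasGaussianLaw_integral φ Λ).aemeasurable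
      (measurable_pi_apply k).aestronglyMeasurable, h.integral_integral_eq_zero]
  orth k l hkl := by
    rw [integral_map (h.hasGaussianLaw_integral φ Λ).aemeasurable
      (Continuous.aestronglyMeasurable (by fun_prop)), h.integral_integral_mul_conj,
      if_neg fun hkl' => hkl (Subtype.ext hkl')]

/-- Moment bounds for off-diagonal quadratic forms of elementary integrals. -/
theorem IsCylindricalWiener.eLpNorm_sesq_le (h : IsCylindricalWiener P β)
    (φ : Mode → ElementaryFunction) (Λ : Finset Mode) {A : Λ → Λ → ℂ} (hA : ∀ k, A k k = 0)
    {r : ℝ≥0∞} (hr : 2 ≤ r) (ht : r ≠ ∞) :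
    eLpNorm (fun ω => sesq A (fun k : Λ => (φ k).integral (β k) ω)
        (fun k : Λ => (φ k).integral (β k) ω)) r P ≤
      2 * (2 * gaussianMoment r) ^ 2 *
        weightedHS A (fun k => eLpNorm ((φ k).integral (β k)) 2 P ^ 2) ^ (1 / 2 : ℝ) := by
  have hm := (h.hasGaussianLaw_integral φ Λ).aemeasurable
  have := (h.isOrthogonalGaussian φ Λ).eLpNorm_sesq_self_le hA hr ht
  rw [eLpNorm_map_measure (Continuous.aestronglyMeasurable (by fun_prop)) hm] at this
  simp_rw [eLpNorm_map_measure (f := fun ω (k : Λ) => (φ k).integral (β k) ω)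
    (g := fun x : Λ → ℂ => x _) (p := 2) (measurable_pi_apply _).aestronglyMeasurable hm] at this
  exact this

end

/-! ### Quadratic forms of the stochastic convolution -/

/-- Fatou's lemma for moments along a sequence that converges in mean square. -/
theorem eLpNorm_le_of_tendsto_eLpNorm_sub {α E : Type*} [MeasurableSpace α] {μ : Measure α}
    [NormedAddCommGroup E] {f : ℕ → α → E} {g : α → E} (hf : ∀ n, AEStronglyMeasurable (f n) μ)
    (hg : AEStronglyMeasurable g μ)
    (hlim : Tendsto (fun n => eLpNorm (f n - g) 2 μ) atTop (𝓝 0)) {F : Type*}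
    [NormedAddCommGroup F] {Φ : E → F} (hΦ : Continuous Φ) {r : ℝ≥0∞} {C : ℕ → ℝ≥0∞}
    {C' : ℝ≥0∞} (hC : Tendsto C atTop (𝓝 C'))
    (hb : ∀ n, eLpNorm (fun x => Φ (f n x)) r μ ≤ C n) :
    eLpNorm (fun x => Φ (g x)) r μ ≤ C' := by
  obtain ⟨ns, hns, hae⟩ :=
    (tendstoInMeasure_of_tendsto_eLpNorm two_ne_zero hf hg hlim).exists_seq_tendsto_ae
  have h1 := Lp.eLpNorm_lim_le_liminf_eLpNorm (p := r) (μ := μ)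
    (f := fun n x => Φ (f (ns n) x)) (fun n => hΦ.comp_aestronglyMeasurable (hf _))
    (fun x => Φ (g x)) (by
      filter_upwards [hae] with x hx
      exact (hΦ.tendsto _).comp hx)
  refine h1.trans ?_
  rw [← (hC.comp hns.tendsto_atTop).liminf_eq]
  exact liminf_le_liminf (Eventually.of_forall fun n => hb (ns n))

theorem tendsto_eLpNorm_pi {α ι : Type*} [MeasurableSpace α] {μ : Measure α} [Fintype ι]
    {f : ℕ → α → ι → ℂ} {g : α → ι → ℂ}
    (hf : ∀ n k, AEStronglyMeasurable (fun x => f n x k) μ)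
    (hg : ∀ k, AEStronglyMeasurable (fun x => g x k) μ)
    (h : ∀ k, Tendsto (fun n => eLpNorm (fun x => f n x k - g x k) 2 μ) atTop (𝓝 0)) :
    Tendsto (fun n => eLpNorm (f n - g) 2 μ) atTop (𝓝 0) := by
  have hsum : Tendsto (fun n => ∑ k, eLpNorm (fun x => f n x k - g x k) 2 μ) atTop (𝓝 0) := by
    simpa using tendsto_finsetSum (Finset.univ : Finset ι) fun k _ => h k
  refine tendsto_of_tendsto_of_tendsto_of_le_of_le tendsto_const_nhds hsum (fun _ => zero_le)
    fun n => ?_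
  calc eLpNorm (f n - g) 2 μ
      ≤ eLpNorm (∑ k, fun x => ‖f n x k - g x k‖) 2 μ := by
        refine eLpNorm_mono_real fun x => ?_
        rw [Finset.sum_apply]
        refine (pi_norm_le_iff_of_nonneg (Finset.sum_nonneg fun k _ => norm_nonneg _)).2 fun k => ?_
        exact Finset.single_le_sum (f := fun k => ‖f n x k - g x k‖)
          (fun k _ => norm_nonneg _) (Finset.mem_univ k)
    _ ≤ ∑ k, eLpNorm (fun x => ‖f n x k - g x k‖) 2 μ :=
        eLpNorm_sum_le (fun k _ => ((hf n k).sub (hg k)).norm) (by norm_num)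
    _ = ∑ k, eLpNorm (fun x => f n x k - g x k) 2 μ := by simp only [eLpNorm_norm]

theorem Mode.one_le_length (k : Mode) : 1 ≤ k.length := by
  have hk : k.1 0 ≠ 0 ∨ k.1 1 ≠ 0 := by
    by_contra! h
    exact k.2 (funext fun j => by fin_cases j <;> simp [h.1, h.2])
  have h1 : 1 ≤ k.1 0 ^ 2 + k.1 1 ^ 2 := by
    rcases hk with h | h
    · nlinarith [sq_nonneg (k.1 1), (sq_pos_iff.2 h : 0 < k.1 0 ^ 2)]
    · nlinarith [sq_nonneg (k.1 0), (sq_pos_iff.2 h : 0 < k.1 1 ^ 2)]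
  rw [Mode.length, Real.one_le_sqrt]
  exact_mod_cast h1

theorem Mode.length_pos (k : Mode) : 0 < k.length := zero_lt_one.trans_le k.one_le_length

/-- A bound for the variance of the mode `k` of the stochastic convolution, uniform in time. -/
def modeVar (k : Mode) : ℝ≥0∞ := ENNReal.ofReal ((2 * k.length ^ 4)⁻¹)

theorem memLp_convolutionKernel (k : Mode) (t : ℝ≥0) :
    MemLp (fun s : ℝ => Real.exp (-(k.length ^ 4) * ((t : ℝ) - s))) 2
      (volume.restrict (Set.Ioc (0 : ℝ) (t : ℝ))) := by
  refine MemLp.of_bound (Continuous.aestronglyMeasurable (by fun_prop)) 1 ?_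
  filter_upwards [ae_restrict_mem measurableSet_Ioc] with s hs
  rw [Real.norm_eq_abs, Real.abs_exp, Real.exp_le_one_iff]
  have := pow_pos k.length_pos 4
  nlinarith [hs.2]

/-- With `a = |k|⁴` the integral of the squared kernel is `(1 - exp(-2at)) / (2a)`, and dropping the
exponential removes the dependence on `t`. -/
theorem eLpNorm_convolutionKernel_le (k : Mode) (t : ℝ≥0) :
    eLpNorm (fun s : ℝ => Real.exp (-(k.length ^ 4) * ((t : ℝ) - s))) 2
      (volume.restrict (Set.Ioc (0 : ℝ) (t : ℝ))) ^ 2 ≤ modeVar k := by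
  rw [eLpNorm_two_sq_eq_ofReal (memLp_convolutionKernel k t), modeVar]
  refine ENNReal.ofReal_le_ofReal ?_
  have hl := pow_pos k.length_pos 4
  set a := k.length ^ 4
  have h1 (s : ℝ) : ‖Real.exp (-a * ((t : ℝ) - s))‖ ^ 2 =
      Real.exp (-(2 * a * t)) * Real.exp ((2 * a) * s) := by
    rw [Real.norm_eq_abs, Real.abs_exp, ← Real.exp_nat_mul, ← Real.exp_add]
    congr 1; push_cast; ring
  simp_rw [h1]
  rw [integral_const_mul, ← intervalIntegral.integral_of_le t.coe_nonneg,
    intervalIntegral.integral_comp_mul_left (fun x => Real.exp x) (by positivity : 2 * a ≠ 0),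
    integral_exp, smul_eq_mul, mul_zero, Real.exp_zero, mul_left_comm, mul_sub, ← Real.exp_add,
    neg_add_cancel, Real.exp_zero]
  have : 0 < Real.exp (-(2 * a * t)) := Real.exp_pos _
  have h2 : (0 : ℝ) < (2 * a)⁻¹ := by positivity
  nlinarith

/-- The constant in the moment bound for quadratic forms of the stochastic convolution. -/
def chaosConst (r : ℝ≥0∞) : ℝ≥0∞ := 2 * (2 * gaussianMoment r) ^ 2

theorem chaosConst_ne_top {r : ℝ≥0∞} (hr : r ≠ ∞) : chaosConst r ≠ ∞ :=
  ENNReal.mul_ne_top (by simp)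
    (ENNReal.pow_ne_top (ENNReal.mul_ne_top (by simp) (gaussianMoment_ne_top hr)))

theorem tendsto_weightedHS {ι : Type*} [Fintype ι] (A : ι → ι → ℂ) {s : ℕ → ι → ℝ≥0∞}
    {s' : ι → ℝ≥0∞} (hs' : ∀ k, s' k ≠ ∞) (h : ∀ k, Tendsto (fun n => s n k) atTop (𝓝 (s' k))) :
    Tendsto (fun n => weightedHS A (s n)) atTop (𝓝 (weightedHS A s')) := by
  unfold weightedHS
  refine tendsto_finsetSum _ fun k _ => tendsto_finsetSum _ fun l _ => ?_
  refine ENNReal.Tendsto.const_mul ?_ (Or.inr (ENNReal.pow_ne_top enorm_ne_top))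
  exact ENNReal.Tendsto.mul (h k) (Or.inr (hs' l)) (h l) (Or.inr (hs' k))

theorem weightedHS_mono {ι : Type*} [Fintype ι] (A : ι → ι → ℂ) {s s' : ι → ℝ≥0∞}
    (h : ∀ k, s k ≤ s' k) : weightedHS A s ≤ weightedHS A s' := by
  unfold weightedHS
  gcongr <;> exact h _

section

variable {Ω : Type*} [MeasurableSpace Ω] {P : Measure Ω} {β : Mode → ℝ≥0 → Ω → ℂ}
  {z : ℝ≥0 → Ω → Mode → ℂ}

/-- Gaussianity of `z` itself is never established: the bound holds for the approximating elementary
integrals, whose variances converge, and Fatou's lemma carries it to the limit. -/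
theorem IsStochasticConvolution.eLpNorm_sesq_le (hβ : IsCylindricalWiener P β)
    (hz : IsStochasticConvolution P β z) (t : ℝ≥0) (Λ : Finset Mode) {A : Λ → Λ → ℂ}
    (hA : ∀ k, A k k = 0) {r : ℝ≥0∞} (hr : 2 ≤ r) (ht : r ≠ ∞) :
    eLpNorm (fun ω => sesq A (fun k : Λ => z t ω k) (fun k : Λ => z t ω k)) r P ≤
      chaosConst r * weightedHS A (fun k => modeVar k) ^ (1 / 2 : ℝ) := by
  choose hm φ hφt hφf hφz using fun k => hz k t
  let f (k : Mode) (s : ℝ) : ℝ := Real.exp (-(k.length ^ 4) * ((t : ℝ) - s))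
  let ν : Measure ℝ := volume.restrict (Set.Ioc (0 : ℝ) (t : ℝ))
  let ε (n : ℕ) (k : Mode) : ℝ≥0∞ := eLpNorm (fun s => f k s - (φ k n).value s) 2 ν
  have hf (k : Mode) : MemLp (f k) 2 ν := memLp_convolutionKernel k t
  -- The Itô isometry turns the size of the elementary integral into that of the step function,
  -- which is within `ε n k` of the kernel.
  have hI (n : ℕ) (k : Mode) :
      eLpNorm ((φ k n).integral (β k)) 2 P ≤ eLpNorm (f k) 2 ν + ε n k := by
    rw [hβ.eLpNorm_integral k (φ k n) (hφt k n)]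
    have h1 : (φ k n).value = f k - fun s => f k s - (φ k n).value s := by ext s; simp
    calc eLpNorm (φ k n).value 2 ν = eLpNorm (f k - fun s => f k s - (φ k n).value s) 2 ν := by
          rw [← h1]
      _ ≤ _ := eLpNorm_sub_le (hf k).aestronglyMeasurable
          ((hf k).sub ((φ k n).memLp_value t)).aestronglyMeasurable (by norm_num)
  have hlim : Tendsto (fun n => eLpNorm ((fun ω (k : Λ) => (φ k n).integral (β k) ω) -
      fun ω (k : Λ) => z t ω k) 2 P) atTop (𝓝 0) := by
    refine tendsto_eLpNorm_pi (fun n k => (hβ.memLp_integral k (φ k n)).aestronglyMeasurable)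
      (fun k => (hm k).aestronglyMeasurable) fun k => ?_
    refine (hφz k).congr fun n => ?_
    rw [← eLpNorm_neg]
    congr 1
    ext ω
    simp
  have hsq (k : Λ) : Tendsto (fun n => (eLpNorm (f k) 2 ν + ε n k) ^ 2) atTop
      (𝓝 (eLpNorm (f k) 2 ν ^ 2)) := by
    have h1 : Tendsto (fun n => eLpNorm (f k) 2 ν + ε n k) atTop (𝓝 (eLpNorm (f k) 2 ν + 0)) :=
      tendsto_const_nhds.add (hφf k)
    rw [add_zero] at h1
    exact ((ENNReal.continuous_pow 2).tendsto _).comp h1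
  have hbound : eLpNorm (fun ω => sesq A (fun k : Λ => z t ω k) (fun k : Λ => z t ω k)) r P ≤
      chaosConst r * weightedHS A (fun k => eLpNorm (f k) 2 ν ^ 2) ^ (1 / 2 : ℝ) := by
    refine eLpNorm_le_of_tendsto_eLpNorm_sub
      (C := fun n => chaosConst r *
        weightedHS A (fun k => (eLpNorm (f k) 2 ν + ε n k) ^ 2) ^ (1 / 2 : ℝ))
      (Φ := fun x : Λ → ℂ => sesq A x x)
      (fun n => (hβ.hasGaussianLaw_integral (fun k => φ k n) Λ).aemeasurable.aestronglyMeasurable)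
      (aemeasurable_pi_lambda (fun ω (k : Λ) => z t ω k) fun k => hm k).aestronglyMeasurable
      hlim (by fun_prop) ?_ ?_
    · refine ENNReal.Tendsto.const_mul ?_ (Or.inr (chaosConst_ne_top ht))
      refine (ENNReal.continuous_rpow_const.tendsto _).comp ?_
      exact tendsto_weightedHS A (fun k => ENNReal.pow_ne_top (hf k).2.ne) hsq
    · intro n
      refine (hβ.eLpNorm_sesq_le (fun k => φ k n) Λ hA hr ht).trans ?_
      unfold chaosConst
      gcongr
      exact weightedHS_mono A fun k => pow_le_pow_left' (hI n k) 2
  refine hbound.trans ?_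
  gcongr
  exact weightedHS_mono A fun k => eLpNorm_convolutionKernel_le k t

/-- Moment bounds for off-diagonal quadratic expressions in the stochastic convolution. -/
theorem IsStochasticConvolution.eLpNorm_quadratic_le (hβ : IsCylindricalWiener P β)
    (hz : IsStochasticConvolution P β z) (t : ℝ≥0) (Λ : Finset Mode) {A : Mode → Mode → ℂ}
    (hA : ∀ k, A k k = 0) {r : ℝ≥0∞} (hr : 2 ≤ r) (ht : r ≠ ∞) :
    eLpNorm (fun ω => ∑ k ∈ Λ, ∑ l ∈ Λ, A k l * (z t ω k * (starRingEnd ℂ) (z t ω l))) r P ≤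
      chaosConst r *
        (∑' k, ∑' l, ‖A k l‖ₑ ^ 2 * (modeVar k * modeVar l)) ^ (1 / 2 : ℝ) := by
  have h1 := hz.eLpNorm_sesq_le hβ t Λ (A := fun k l => A k l) (fun k => hA k) hr ht
  have h2 (ω : Ω) : sesq (fun k l : Λ => A k l) (fun k : Λ => z t ω k) (fun k : Λ => z t ω k) =
      ∑ k ∈ Λ, ∑ l ∈ Λ, A k l * (z t ω k * (starRingEnd ℂ) (z t ω l)) := by
    rw [sesq, ← Finset.sum_coe_sort Λ]
    refine Finset.sum_congr rfl fun k _ => ?_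
    rw [← Finset.sum_coe_sort Λ]
  simp_rw [h2] at h1
  refine h1.trans ?_
  gcongr
  unfold weightedHS
  calc ∑ k : Λ, ∑ l : Λ, ‖A k l‖ₑ ^ 2 * (modeVar k * modeVar l)
      = ∑ k ∈ Λ, ∑ l ∈ Λ, ‖A k l‖ₑ ^ 2 * (modeVar k * modeVar l) := by
        rw [← Finset.sum_coe_sort Λ]
        refine Finset.sum_congr rfl fun k _ => ?_
        rw [← Finset.sum_coe_sort Λ]
    _ ≤ ∑ k ∈ Λ, ∑' l, ‖A k l‖ₑ ^ 2 * (modeVar k * modeVar l) :=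
        Finset.sum_le_sum fun k _ => ENNReal.sum_le_tsum Λ
    _ ≤ _ := ENNReal.sum_le_tsum Λ

theorem IsStochasticConvolution.aemeasurable (hz : IsStochasticConvolution P β z) (t : ℝ≥0)
    (k : Mode) : AEMeasurable (fun ω => z t ω k) P := (hz k t).1

end

/-! ### Plane waves -/

/-- The plane wave `exp(i κ·x)`. -/
def wave (κ : Fin 2 → ℤ) (x : Plane) : ℂ :=
  Complex.exp (Complex.I * (((κ 0 : ℝ) * x 0 + (κ 1 : ℝ) * x 1 : ℝ) : ℂ))

theorem basisFun_eq_wave (k : Mode) (x : Plane) :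
    basisFun k x = (((2 * Real.pi)⁻¹ : ℝ) : ℂ) * wave k.1 x := rfl

theorem wave_mul_conj (κ ν : Fin 2 → ℤ) (x : Plane) :
    wave κ x * (starRingEnd ℂ) (wave ν x) = wave (κ - ν) x := by
  unfold wave
  rw [← Complex.exp_conj, ← Complex.exp_add]
  congr 1
  rw [map_mul, Complex.conj_ofReal, Complex.conj_I]
  simp only [Pi.sub_apply]
  push_cast
  ring

/-- The linear form `x ↦ i κ·x`. -/
def wavePhase (κ : Fin 2 → ℤ) : Plane →L[ℝ] ℂ :=
  (((κ 0 : ℝ) • (EuclideanSpace.proj (𝕜 := ℝ) (0 : Fin 2) : Plane →L[ℝ] ℝ) +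
    (κ 1 : ℝ) • (EuclideanSpace.proj (𝕜 := ℝ) (1 : Fin 2) : Plane →L[ℝ] ℝ)).smulRight Complex.I)

theorem wavePhase_apply (κ : Fin 2 → ℤ) (x : Plane) :
    wavePhase κ x = Complex.I * (((κ 0 : ℝ) * x 0 + (κ 1 : ℝ) * x 1 : ℝ) : ℂ) := by
  simp [wavePhase]
  ring

theorem wavePhase_single (κ : Fin 2 → ℤ) (j : Fin 2) :
    wavePhase κ (EuclideanSpace.single j (1 : ℝ)) = Complex.I * (κ j : ℂ) := by
  rw [wavePhase_apply]
  fin_cases j <;> simp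

theorem hasFDerivAt_wave (κ : Fin 2 → ℤ) (x : Plane) :
    HasFDerivAt (wave κ) (wave κ x • wavePhase κ) x := by
  have h : wave κ = fun x => Complex.exp (wavePhase κ x) := by
    ext x; rw [wavePhase_apply]; rfl
  rw [h]
  exact (wavePhase κ).hasFDerivAt.cexp

theorem continuous_wave (κ : Fin 2 → ℤ) : Continuous (wave κ) :=
  continuous_iff_continuousAt.2 fun x => (hasFDerivAt_wave κ x).continuousAt

theorem hasFDerivAt_sum_wave {ι : Type*} (S : Finset ι) (c : ι → ℂ) (κ : ι → Fin 2 → ℤ)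
    (x : Plane) :
    HasFDerivAt (fun x => ∑ i ∈ S, c i * wave (κ i) x)
      (∑ i ∈ S, (c i * wave (κ i) x) • wavePhase (κ i)) x := by
  refine HasFDerivAt.fun_sum fun i _ => ?_
  have := (hasFDerivAt_wave (κ i) x).const_mul (c i)
  rwa [smul_smul] at this

theorem partialDeriv_sum_wave {ι : Type*} (S : Finset ι) (c : ι → ℂ) (κ : ι → Fin 2 → ℤ)
    (j : Fin 2) (x : Plane) :
    partialDeriv j (fun x => ∑ i ∈ S, c i * wave (κ i) x) x =
      ∑ i ∈ S, c i * wave (κ i) x * (Complex.I * (κ i j : ℂ)) := by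
  unfold partialDeriv
  rw [((hasFDerivAt_sum_wave S c κ x).hasLineDerivAt _).lineDeriv]
  simp [wavePhase_single]

theorem laplacian_sum_wave {ι : Type*} (S : Finset ι) (c : ι → ℂ) (κ : ι → Fin 2 → ℤ) :
    Laplacian.laplacian (fun x => ∑ i ∈ S, c i * wave (κ i) x) =
      fun x => ∑ i ∈ S, -(c i * ((κ i 0 : ℂ) ^ 2 + (κ i 1 : ℂ) ^ 2)) * wave (κ i) x := by
  ext x
  have h1 : fderiv ℝ (fun x => ∑ i ∈ S, c i * wave (κ i) x) =
      fun x => ∑ i ∈ S, (c i * wave (κ i) x) • wavePhase (κ i) := by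
    ext1 x; exact (hasFDerivAt_sum_wave S c κ x).fderiv
  have h2 : HasFDerivAt (fun x => ∑ i ∈ S, (c i * wave (κ i) x) • wavePhase (κ i))
      (∑ i ∈ S, ((c i * wave (κ i) x) • wavePhase (κ i)).smulRight (wavePhase (κ i))) x := by
    refine HasFDerivAt.fun_sum fun i _ => ?_
    have := (hasFDerivAt_wave (κ i) x).const_mul (c i)
    rw [smul_smul] at this
    exact this.smul_const (wavePhase (κ i))
  rw [InnerProductSpace.laplacian_eq_iteratedFDeriv_orthonormalBasis _
    (EuclideanSpace.basisFun (Fin 2) ℝ)]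
  simp only [iteratedFDeriv_two_apply, h1, h2.fderiv, Fin.sum_univ_two]
  simp only [EuclideanSpace.basisFun_apply, sum_apply,
    ContinuousLinearMap.smulRight_apply, smul_apply, wavePhase_single,
    Matrix.cons_val_zero, Matrix.cons_val_one, smul_eq_mul, ← Finset.sum_add_distrib]
  refine Finset.sum_congr rfl fun i _ => ?_
  linear_combination (c i * wave (κ i) x * ((κ i 0 : ℂ) ^ 2 + (κ i 1 : ℂ) ^ 2)) * Complex.I_mul_I

/-! ### Integrals over the fundamental cell -/

theorem integral_exp_int (n : ℤ) :
    ∫ x in Set.Icc (-Real.pi) Real.pi, Complex.exp (Complex.I * (((n : ℝ) * x : ℝ) : ℂ)) =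
      if n = 0 then ((2 * Real.pi : ℝ) : ℂ) else 0 := by
  rw [integral_Icc_eq_integral_Ioc, ← intervalIntegral.integral_of_le (by linarith [Real.pi_pos])]
  split_ifs with h
  · subst h
    simp
    ring
  · have hc : Complex.I * (n : ℂ) ≠ 0 := mul_ne_zero Complex.I_ne_zero (by exact_mod_cast h)
    have h1 : ∀ x : ℝ, Complex.I * (((n : ℝ) * x : ℝ) : ℂ) = Complex.I * (n : ℂ) * x := fun x => by
      push_cast; ring
    simp_rw [h1]
    rw [integral_exp_mul_complex hc, div_eq_zero_iff]
    left
    rw [sub_eq_zero, Complex.exp_eq_exp_iff_exists_int]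
    exact ⟨n, by push_cast; ring⟩

theorem integral_cell_wave (κ : Fin 2 → ℤ) :
    ∫ x in cell, wave κ x = if κ = 0 then ((2 * Real.pi : ℝ) : ℂ) ^ 2 else 0 := by
  let g (n : ℤ) (x : ℝ) : ℂ := Complex.exp (Complex.I * (((n : ℝ) * x : ℝ) : ℂ))
  let e : Plane ≃ᵐ ℝ × ℝ :=
    (MeasurableEquiv.toLp 2 (Fin 2 → ℝ)).symm.trans MeasurableEquiv.finTwoArrow
  have he : MeasurePreserving e volume volume :=
    (EuclideanSpace.volume_preserving_symm_measurableEquiv_toLp (Fin 2)).trans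
      (volume_preserving_finTwoArrow ℝ)
  have hcell : cell = e ⁻¹' (Set.Icc (-Real.pi) Real.pi ×ˢ Set.Icc (-Real.pi) Real.pi) := by
    ext x
    simp only [cell, Set.mem_ofPred_eq, Fin.forall_fin_two, Set.mem_preimage, Set.mem_prod]
    rfl
  have hwave : wave κ = fun x => (fun p : ℝ × ℝ => g (κ 0) p.1 * g (κ 1) p.2) (e x) := by
    ext x
    simp only [wave, g, ← Complex.exp_add]
    congr 1
    change _ = Complex.I * (((κ 0 : ℝ) * x 0 : ℝ) : ℂ) + Complex.I * (((κ 1 : ℝ) * x 1 : ℝ) : ℂ)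
    push_cast
    ring
  rw [hcell, hwave, he.setIntegral_preimage_emb e.measurableEmbedding, Measure.volume_eq_prod,
    setIntegral_prod_mul, integral_exp_int, integral_exp_int]
  have : κ = 0 ↔ κ 0 = 0 ∧ κ 1 = 0 := by
    rw [funext_iff, Fin.forall_fin_two]; rfl
  simp only [this]
  split_ifs <;> simp_all [pow_two]

theorem isCompact_cell : IsCompact cell := by
  have : cell = (EuclideanSpace.equiv (Fin 2) ℝ) ⁻¹'
      (Set.univ.pi fun _ => Set.Icc (-Real.pi) Real.pi) := by
    ext x
    simp only [cell, Set.mem_ofPred_eq, Set.mem_preimage, Set.mem_univ_pi]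
    rfl
  rw [this]
  exact (EuclideanSpace.equiv (Fin 2) ℝ).toHomeomorph.isClosedEmbedding.isCompact_preimage
    (isCompact_univ_pi fun _ => isCompact_Icc)

theorem coeff_sum_wave {ι : Type*} (S : Finset ι) (c : ι → ℂ) (κ : ι → Fin 2 → ℤ) (m : Mode) :
    coeff (fun x => ∑ i ∈ S, c i * wave (κ i) x) m =
      ∑ i ∈ S, if κ i = m.1 then c i * ((2 * Real.pi : ℝ) : ℂ) else 0 := by
  have hpi : ((2 * Real.pi : ℝ) : ℂ) ≠ 0 := by
    exact_mod_cast (mul_pos two_pos Real.pi_pos).ne'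
  unfold coeff
  have h1 (x : Plane) : (∑ i ∈ S, c i * wave (κ i) x) * (starRingEnd ℂ) (basisFun m x) =
      ∑ i ∈ S, (c i * (((2 * Real.pi)⁻¹ : ℝ) : ℂ)) * wave (κ i - m.1) x := by
    rw [basisFun_eq_wave, map_mul, Complex.conj_ofReal, Finset.sum_mul]
    refine Finset.sum_congr rfl fun i _ => ?_
    rw [← wave_mul_conj]; ring
  simp_rw [h1]
  rw [integral_finsetSum _ fun i _ =>
    (((continuous_wave _).continuousOn.integrableOn_compact isCompact_cell).const_mul _)]
  refine Finset.sum_congr rfl fun i _ => ?_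
  rw [integral_const_mul, integral_cell_wave]
  simp only [sub_eq_zero]
  split_ifs
  · rw [Complex.ofReal_inv, pow_two, mul_assoc, inv_mul_cancel_left₀ hpi]
  · simp

/-! ### The Galerkin nonlinearity in Fourier space -/

/-- The Fourier multiplier of the nonlinearity. -/
def bilinearKernel (m k l : Mode) : ℂ :=
  if k.1 - l.1 = m.1 then
    ((-((2 * Real.pi)⁻¹ * m.length ^ 2 * ((k.1 0 : ℝ) * l.1 0 + (k.1 1 : ℝ) * l.1 1)) : ℝ) : ℂ)
  else 0

theorem Mode.length_sq (k : Mode) : k.length ^ 2 = (k.1 0 : ℝ) ^ 2 + (k.1 1 : ℝ) ^ 2 :=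
  Real.sq_sqrt (by positivity)

/-- The product of gradients is a trigonometric polynomial with frequencies `k - l` and factors
`(2π)⁻² k·l`. The Laplacian contributes `-|m|²`, and pairing with `e_m` returns a factor `2π`. -/
theorem galerkinNonlin_eq (N : ℕ) (u v : Mode → ℂ) (m : Mode) :
    galerkinNonlin N u v m = ∑ k ∈ modesUpTo N, ∑ l ∈ modesUpTo N,
      bilinearKernel m k l * (u k * (starRingEnd ℂ) (v l)) := by
  have hpi : ((2 * Real.pi : ℝ) : ℂ) ≠ 0 := by
    exact_mod_cast (mul_pos two_pos Real.pi_pos).ne'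
  set a : ℂ := (((2 * Real.pi)⁻¹ : ℝ) : ℂ) with ha
  have hproj (u : Mode → ℂ) : galerkinProj N u =
      fun x => ∑ k ∈ modesUpTo N, (u k * a) * wave k.1 x := by
    ext x
    simp only [galerkinProj, basisFun_eq_wave, mul_assoc, ha]
  have hgrad : (fun x : Plane => ∑ j : Fin 2, partialDeriv j (galerkinProj N u) x *
      (starRingEnd ℂ) (partialDeriv j (galerkinProj N v) x)) =
      fun x => ∑ p ∈ modesUpTo N ×ˢ modesUpTo N,
        (u p.1 * (starRingEnd ℂ) (v p.2) * a ^ 2 *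
          ((p.1.1 0 : ℂ) * (p.2.1 0 : ℂ) + (p.1.1 1 : ℂ) * (p.2.1 1 : ℂ))) *
          wave (p.1.1 - p.2.1) x := by
    ext x
    simp only [hproj, partialDeriv_sum_wave, map_sum, Finset.sum_mul_sum, Fin.sum_univ_two,
      ← Finset.sum_add_distrib, Finset.sum_product, ← wave_mul_conj]
    refine Finset.sum_congr rfl fun k _ => Finset.sum_congr rfl fun l _ => ?_
    simp only [map_mul, Complex.conj_I, ha, Complex.conj_ofReal, map_intCast]
    linear_combination -(u k * (starRingEnd ℂ) (v l) * a ^ 2 *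
          ((k.1 0 : ℂ) * (l.1 0 : ℂ) + (k.1 1 : ℂ) * (l.1 1 : ℂ))) *
          (wave k.1 x * (starRingEnd ℂ) (wave l.1 x)) * Complex.I_mul_I
  unfold galerkinNonlin nonlin
  rw [hgrad, laplacian_sum_wave, coeff_sum_wave, Finset.sum_product]
  refine Finset.sum_congr rfl fun k _ => Finset.sum_congr rfl fun l _ => ?_
  unfold bilinearKernel
  split_ifs with h
  · rw [h, Mode.length_sq]
    have : a * ((2 * Real.pi : ℝ) : ℂ) = 1 := by
      rw [ha, Complex.ofReal_inv, inv_mul_cancel₀ hpi]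
    push_cast at this ha ⊢
    rw [← ha]
    linear_combination (-(u k * (starRingEnd ℂ) (v l) * a *
      ((k.1 0 : ℂ) * (l.1 0 : ℂ) + (k.1 1 : ℂ) * (l.1 1 : ℂ)) *
      ((m.1 0 : ℂ) ^ 2 + (m.1 1 : ℂ) ^ 2))) * this
  · simp

/-! ### Lattice sums -/

theorem Mode.length_eq_norm (k : Mode) :
    k.length = ‖((k.1 0 : ℝ) : ℂ) + ((k.1 1 : ℝ) : ℂ) * Complex.I‖ := by
  rw [Complex.norm_add_mul_I]; rfl

theorem Mode.length_le_add {m k l : Mode} (h : k.1 - l.1 = m.1) :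
    m.length ≤ k.length + l.length := by
  simp only [Mode.length_eq_norm, ← h]
  refine le_trans (le_of_eq ?_) (norm_sub_le _ _)
  congr 1
  simp only [Pi.sub_apply]
  push_cast
  ring

theorem Mode.norm_le_length (k : Mode) : ‖k.1‖ ≤ k.length := by
  refine (pi_norm_le_iff_of_nonneg k.length_pos.le).2 fun j => ?_
  rw [Int.norm_eq_abs, Mode.length]
  refine Real.abs_le_sqrt ?_
  fin_cases j
  · simpa using sq_nonneg (k.1 1 : ℝ)
  · simpa using sq_nonneg (k.1 0 : ℝ)

theorem Mode.inner_sq_le (k l : Mode) :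
    ((k.1 0 : ℝ) * l.1 0 + (k.1 1 : ℝ) * l.1 1) ^ 2 ≤ k.length ^ 2 * l.length ^ 2 := by
  rw [k.length_sq, l.length_sq]
  nlinarith [sq_nonneg ((k.1 0 : ℝ) * l.1 1 - (k.1 1 : ℝ) * l.1 0)]

/-- The Euclidean length dominates the sup norm, for which summability over the rank-two lattice is
the Eisenstein series bound. -/
theorem tsum_length_rpow_ne_top {a : ℝ} (ha : 2 < a) :
    ∑' k : Mode, ENNReal.ofReal (k.length ^ (-a)) ≠ ∞ := by
  have h1 : Summable fun k : Mode => ‖k.1‖ ^ (-a) :=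
    (EisensteinSeries.summable_one_div_norm_rpow ha).subtype _
  have h2 : Summable fun k : Mode => k.length ^ (-a) := by
    refine h1.of_nonneg_of_le (fun k => Real.rpow_nonneg k.length_pos.le _) fun k => ?_
    exact Real.rpow_le_rpow_of_nonpos (norm_pos_iff.2 k.2) k.norm_le_length (by linarith)
  exact h2.tsum_ofReal_ne_top

/-- The larger length `y` satisfies both `y ≥ w / 2` and `y ≥ x`. Splitting `y⁻²` as `y^{-(2-g)}
y^{-g}` and giving one factor to each of `w` and `x` leaves two exponents beyond the summability
threshold 2. The constant 4 bounds `2^{2-g}`. -/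
theorem rpow_product_bound {g x y w : ℝ} (hg0 : 0 < g) (hg1 : g ≤ 1) (hx : 1 ≤ x) (hw : 1 ≤ w)
    (hxy : x ≤ y) (hwy : w ≤ x + y) :
    w ^ (-(2 * g)) * (x ^ (-2 : ℝ) * y ^ (-2 : ℝ)) ≤ 4 * (w ^ (-(2 + g)) * x ^ (-(2 + g))) := by
  have hx0 : 0 < x := by linarith
  have hw0 : 0 < w := by linarith
  have hy0 : 0 < y := by linarith
  have hy : y ^ (-2 : ℝ) = y ^ (-(2 - g)) * y ^ (-g) := by
    rw [← Real.rpow_add hy0]; congr 1; ring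
  have h1 : y ^ (-g) ≤ x ^ (-g) := Real.rpow_le_rpow_of_nonpos hx0 hxy (by linarith)
  have h2 : y ^ (-(2 - g)) ≤ 4 * w ^ (-(2 - g)) := by
    calc y ^ (-(2 - g)) ≤ (w / 2) ^ (-(2 - g)) :=
          Real.rpow_le_rpow_of_nonpos (by linarith) (by linarith) (by linarith)
      _ = w ^ (-(2 - g)) * 2 ^ (2 - g) := by
          rw [Real.div_rpow hw0.le (by norm_num), Real.rpow_neg (by norm_num : (0 : ℝ) ≤ 2),
            div_inv_eq_mul]
      _ ≤ w ^ (-(2 - g)) * 2 ^ (2 : ℝ) := by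
          gcongr
          · norm_num
          · linarith
      _ = 4 * w ^ (-(2 - g)) := by norm_num; ring
  have e1 : w ^ (-(2 + g)) = w ^ (-(2 * g)) * w ^ (-(2 - g)) := by
    rw [← Real.rpow_add hw0]; congr 1; ring
  have e2 : x ^ (-(2 + g)) = x ^ (-2 : ℝ) * x ^ (-g) := by
    rw [← Real.rpow_add hx0]; congr 1; ring
  calc w ^ (-(2 * g)) * (x ^ (-2 : ℝ) * y ^ (-2 : ℝ))
      = w ^ (-(2 * g)) * x ^ (-2 : ℝ) * (y ^ (-(2 - g)) * y ^ (-g)) := by rw [hy]; ring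
    _ ≤ w ^ (-(2 * g)) * x ^ (-2 : ℝ) * ((4 * w ^ (-(2 - g))) * x ^ (-g)) := by gcongr
    _ = 4 * (w ^ (-(2 + g)) * x ^ (-(2 + g))) := by rw [e1, e2]; ring

/-- The weights of the Sobolev norm. -/
def sobolevWeight (s : ℝ) (m : Mode) : ℝ≥0∞ := ENNReal.ofReal (m.length ^ (2 * s))

theorem sobolevWeight_ne_top (s : ℝ) (m : Mode) : sobolevWeight s m ≠ ∞ := ENNReal.ofReal_ne_top

theorem sobolevWeight_ne_zero (s : ℝ) (m : Mode) : sobolevWeight s m ≠ 0 :=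
  (ENNReal.ofReal_pos.2 (Real.rpow_pos_of_pos m.length_pos _)).ne'

/-- The Sobolev weight absorbs the `|m|⁴` of the squared Laplacian symbol, leaving `|m|^{-2γ}`, and
Cauchy-Schwarz for `k·l` leaves `|k|⁻² |l|⁻²`. The sum of two powers covers both orderings of `|k|`
and `|l|`; `min γ 1` keeps the exponent `2 - g` nonnegative. -/
theorem bilinearKernel_term_le {γ : ℝ} (hγ : 0 < γ) (m k l : Mode) :
    sobolevWeight (-2 - γ) m * (‖bilinearKernel m k l‖ₑ ^ 2 * (modeVar k * modeVar l)) ≤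
      if k.1 - l.1 = m.1 then
        4 * (ENNReal.ofReal (m.length ^ (-(2 + min γ 1))) *
          (ENNReal.ofReal (k.length ^ (-(2 + min γ 1))) +
            ENNReal.ofReal (l.length ^ (-(2 + min γ 1)))))
      else 0 := by
  unfold bilinearKernel
  split_ifs with h
  swap
  · simp
  set g := min γ 1 with hg
  have hg0 : 0 < g := lt_min hγ one_pos
  have hg1 : g ≤ 1 := min_le_right _ _
  have hgγ : g ≤ γ := min_le_left _ _
  have hm := m.length_pos
  have hk := k.length_pos
  have hl := l.length_pos
  have hmk : 0 ≤ m.length ^ (-(2 + g)) * k.length ^ (-(2 + g)) := by positivity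
  have hml : 0 ≤ m.length ^ (-(2 + g)) * l.length ^ (-(2 + g)) := by positivity
  have key : m.length ^ (2 * (-2 - γ)) *
      (((2 * Real.pi)⁻¹ * m.length ^ 2 * ((k.1 0 : ℝ) * l.1 0 + (k.1 1 : ℝ) * l.1 1)) ^ 2 *
        ((2 * k.length ^ 4)⁻¹ * (2 * l.length ^ 4)⁻¹)) ≤
      4 * (m.length ^ (-(2 + g)) * (k.length ^ (-(2 + g)) + l.length ^ (-(2 + g)))) := by
    have hpi : ((2 * Real.pi)⁻¹) ^ 2 ≤ 1 := by
      refine pow_le_one₀ (by positivity) (inv_le_one_of_one_le₀ ?_)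
      linarith [Real.pi_gt_three]
    have e1 : m.length ^ (2 * (-2 - γ)) * m.length ^ 4 = m.length ^ (-(2 * γ)) := by
      rw [← Real.rpow_natCast, ← Real.rpow_add hm]; congr 1; push_cast; ring
    have e2 (j : Mode) : j.length ^ (-2 : ℝ) = (j.length ^ 2)⁻¹ := by
      rw [Real.rpow_neg j.length_pos.le]; norm_cast
    have step1 : m.length ^ (2 * (-2 - γ)) *
      (((2 * Real.pi)⁻¹ * m.length ^ 2 * ((k.1 0 : ℝ) * l.1 0 + (k.1 1 : ℝ) * l.1 1)) ^ 2 *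
        ((2 * k.length ^ 4)⁻¹ * (2 * l.length ^ 4)⁻¹)) ≤
        m.length ^ (-(2 * γ)) * (k.length ^ (-2 : ℝ) * l.length ^ (-2 : ℝ)) := by
      calc _ = (m.length ^ (2 * (-2 - γ)) * m.length ^ 4) * (((2 * Real.pi)⁻¹) ^ 2 *
            ((k.1 0 : ℝ) * l.1 0 + (k.1 1 : ℝ) * l.1 1) ^ 2 *
            ((2 * k.length ^ 4)⁻¹ * (2 * l.length ^ 4)⁻¹)) := by ring
        _ ≤ (m.length ^ (2 * (-2 - γ)) * m.length ^ 4) * (1 * (k.length ^ 2 * l.length ^ 2) *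
            ((k.length ^ 4)⁻¹ * (l.length ^ 4)⁻¹)) := by
            gcongr
            · exact k.inner_sq_le l
            · linarith [pow_pos hk 4]
            · linarith [pow_pos hl 4]
        _ = _ := by
            rw [e1, e2, e2]
            field_simp
    refine step1.trans ?_
    have step2 : m.length ^ (-(2 * γ)) ≤ m.length ^ (-(2 * g)) :=
      Real.rpow_le_rpow_of_exponent_le m.one_le_length (by linarith)
    have step3 : m.length ^ (-(2 * γ)) * (k.length ^ (-2 : ℝ) * l.length ^ (-2 : ℝ)) ≤
        m.length ^ (-(2 * g)) * (k.length ^ (-2 : ℝ) * l.length ^ (-2 : ℝ)) := by gcongr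
    refine step3.trans ?_
    have htri := Mode.length_le_add h
    rcases le_total k.length l.length with hkl | hkl
    · have := rpow_product_bound hg0 hg1 k.one_le_length m.one_le_length hkl htri
      linarith
    · have := rpow_product_bound hg0 hg1 l.one_le_length m.one_le_length hkl
        (by linarith : m.length ≤ l.length + k.length)
      rw [mul_comm (k.length ^ (-2 : ℝ))]
      linarith
  have hnorm : ‖((-((2 * Real.pi)⁻¹ * m.length ^ 2 *
      ((k.1 0 : ℝ) * l.1 0 + (k.1 1 : ℝ) * l.1 1)) : ℝ) : ℂ)‖ₑ ^ 2 =
      ENNReal.ofReal (((2 * Real.pi)⁻¹ * m.length ^ 2 *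
        ((k.1 0 : ℝ) * l.1 0 + (k.1 1 : ℝ) * l.1 1)) ^ 2) := by
    rw [← ofReal_norm, ← ENNReal.ofReal_pow (norm_nonneg _), Complex.norm_real, Real.norm_eq_abs,
      sq_abs, neg_sq]
  rw [hnorm, sobolevWeight, modeVar, modeVar, ← ENNReal.ofReal_mul (by positivity),
    ← ENNReal.ofReal_mul (by positivity), ← ENNReal.ofReal_mul (by positivity),
    ← ENNReal.ofReal_add (by positivity) (by positivity), ← ENNReal.ofReal_mul (by positivity),
    show (4 : ℝ≥0∞) = ENNReal.ofReal 4 by simp, ← ENNReal.ofReal_mul (by norm_num)]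
  exact ENNReal.ofReal_le_ofReal key

theorem tsum_ite_le {α : Type*} {p : α → Prop} [DecidablePred p]
    (hp : ∀ a b, p a → p b → a = b) (c : ℝ≥0∞) : ∑' a, (if p a then c else 0) ≤ c := by
  by_cases h : ∃ a, p a
  · obtain ⟨a, ha⟩ := h
    rw [tsum_eq_single a fun b hb => if_neg fun hpb => hb (hp b a hpb ha), if_pos ha]
  · push Not at h
    simp [h]

/-- The total weight of the quadratic expressions in all Fourier modes is finite. -/
theorem tsum_bilinearKernel_ne_top {γ : ℝ} (hγ : 0 < γ) :
    ∑' p : Mode × Mode × Mode, sobolevWeight (-2 - γ) p.1 *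
      (‖bilinearKernel p.1 p.2.1 p.2.2‖ₑ ^ 2 * (modeVar p.2.1 * modeVar p.2.2)) ≠ ∞ := by
  let h (k : Mode) : ℝ≥0∞ := ENNReal.ofReal (k.length ^ (-(2 + min γ 1)))
  have hS : ∑' k, h k ≠ ∞ :=
    tsum_length_rpow_ne_top (by linarith [lt_min hγ one_pos])
  refine ne_top_of_le_ne_top (b := 4 * ((∑' k, h k) * (∑' k, h k)) +
    4 * ((∑' k, h k) * (∑' k, h k))) (by finiteness) ?_
  calc _ ≤ ∑' p : Mode × Mode × Mode, ((if p.2.1.1 - p.2.2.1 = p.1.1 then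
          4 * (h p.1 * h p.2.1) else 0) +
          (if p.2.1.1 - p.2.2.1 = p.1.1 then 4 * (h p.1 * h p.2.2) else 0)) := by
        refine ENNReal.tsum_le_tsum fun p => (bilinearKernel_term_le hγ _ _ _).trans ?_
        split_ifs
        · rw [mul_add, mul_add]
        · simp
    -- The constrained variable is placed innermost in each sum. It is determined by the other two,
    -- so a product of two convergent sums remains.
    _ = ∑' (m : Mode) (k : Mode) (l : Mode), (if k.1 - l.1 = m.1 then 4 * (h m * h k) else 0) +
          ∑' (m : Mode) (l : Mode) (k : Mode), (if k.1 - l.1 = m.1 then 4 * (h m * h l) else 0) := by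
        rw [ENNReal.tsum_add, ENNReal.tsum_prod', ENNReal.tsum_prod']
        simp_rw [ENNReal.tsum_prod']
        congr 1
        exact tsum_congr fun m => ENNReal.tsum_comm
    _ ≤ ∑' (m : Mode) (k : Mode), 4 * (h m * h k) + ∑' (m : Mode) (l : Mode), 4 * (h m * h l) := by
        gcongr with m k m l
        · refine tsum_ite_le (fun a b ha hb => Subtype.ext ?_) _
          exact sub_right_injective (ha.trans hb.symm)
        · refine tsum_ite_le (fun a b ha hb => Subtype.ext ?_) _
          exact sub_left_injective (ha.trans hb.symm)
    _ = _ := by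
        simp_rw [ENNReal.tsum_mul_left, ENNReal.tsum_mul_right]

/-- Dominated convergence for the counting measure, with `f` itself as the majorant. -/
theorem tendsto_tsum_indicator_zero {α : Type*} {f : α → ℝ≥0∞} (hf : ∑' a, f a ≠ ∞)
    {S : ℕ → Set α} (hS : ∀ a, ∀ᶠ n in atTop, a ∉ S n) :
    Tendsto (fun n => ∑' a, (S n).indicator f a) atTop (𝓝 0) := by
  let _ : MeasurableSpace α := ⊤
  have h := tendsto_lintegral_of_dominated_convergence (μ := Measure.count)
    (F := fun n => (S n).indicator f) (f := fun _ => 0) f (fun n => measurable_from_top)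
    (fun n => Eventually.of_forall fun a => Set.indicator_le_self _ _ a)
    (by rwa [lintegral_count])
    (Eventually.of_forall fun a => tendsto_const_nhds.congr' ((hS a).mono fun n hn =>
      (Set.indicator_of_notMem hn f).symm))
  simpa only [lintegral_count, tsum_zero] using h

/-- The part of the multiplier that is cut off by the Galerkin truncation. -/
def tailKernel (N : ℕ) (m k l : Mode) : ℂ :=
  open Classical in
  if k ∈ modesUpTo N ∧ l ∈ modesUpTo N then 0 else bilinearKernel m k l

/-- The bound for the second moment of a quadratic expression with matrix `A`. -/
def quadVar (A : Mode → Mode → ℂ) : ℝ≥0∞ :=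
  ∑' k, ∑' l, ‖A k l‖ₑ ^ 2 * (modeVar k * modeVar l)

theorem tsum_quadVar_ne_top {γ : ℝ} (hγ : 0 < γ) :
    ∑' m, sobolevWeight (-2 - γ) m * quadVar (bilinearKernel m) ≠ ∞ := by
  have := tsum_bilinearKernel_ne_top hγ
  rw [ENNReal.tsum_prod'] at this
  simp_rw [ENNReal.tsum_prod', ENNReal.tsum_mul_left] at this
  exact this

theorem modesUpTo_mono {N M : ℕ} (h : N ≤ M) : modesUpTo N ⊆ modesUpTo M := fun k hk => by
  rw [mem_modesUpTo] at hk ⊢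
  exact hk.trans (by exact_mod_cast h)

theorem eventually_mem_modesUpTo (k : Mode) : ∀ᶠ N in atTop, k ∈ modesUpTo N := by
  filter_upwards [eventually_ge_atTop ⌈k.length⌉₊] with N hN
  exact (mem_modesUpTo N k).2 ((Nat.le_ceil _).trans (by exact_mod_cast hN))

theorem tendsto_tsum_quadVar_tailKernel {γ : ℝ} (hγ : 0 < γ) :
    Tendsto (fun N => ∑' m, sobolevWeight (-2 - γ) m * quadVar (tailKernel N m)) atTop (𝓝 0) := by
  classical
  have h := tendsto_tsum_indicator_zero (tsum_bilinearKernel_ne_top hγ)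
    (S := fun N => {p | ¬ (p.2.1 ∈ modesUpTo N ∧ p.2.2 ∈ modesUpTo N)}) fun p => by
      filter_upwards [eventually_mem_modesUpTo p.2.1, eventually_mem_modesUpTo p.2.2] with N h1 h2
      exact fun hp => hp ⟨h1, h2⟩
  refine h.congr fun N => ?_
  rw [ENNReal.tsum_prod']
  refine tsum_congr fun m => ?_
  rw [quadVar, ← ENNReal.tsum_mul_left, ENNReal.tsum_prod']
  refine tsum_congr fun k => ?_
  rw [← ENNReal.tsum_mul_left]
  refine tsum_congr fun l => ?_
  by_cases hkl : k ∈ modesUpTo N ∧ l ∈ modesUpTo N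
  · simp [tailKernel, hkl]
  · rw [Set.indicator_of_mem (by exact hkl), tailKernel, if_neg hkl]

/-- Excluding the zero mode removes the diagonal; the decoupling bound therefore applies without any
renormalization constant. -/
theorem bilinearKernel_self (m k : Mode) : bilinearKernel m k k = 0 := by
  rw [bilinearKernel, if_neg]
  rw [sub_self]
  exact fun h => m.2 h.symm

theorem tailKernel_self (N : ℕ) (m k : Mode) : tailKernel N m k k = 0 := by
  rw [tailKernel, bilinearKernel_self, ite_self]

/-- The difference is again an off-diagonal quadratic form, now with the tail kernel, so the same
moment bound measures the Cauchy property. -/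
theorem galerkinNonlin_sub {N M : ℕ} (h : N ≤ M) (u : Mode → ℂ) (m : Mode) :
    galerkinNonlin M u u m - galerkinNonlin N u u m =
      ∑ k ∈ modesUpTo M, ∑ l ∈ modesUpTo M,
        tailKernel N m k l * (u k * (starRingEnd ℂ) (u l)) := by
  classical
  have h1 : galerkinNonlin N u u m = ∑ k ∈ modesUpTo M, ∑ l ∈ modesUpTo M,
      if k ∈ modesUpTo N ∧ l ∈ modesUpTo N then
        bilinearKernel m k l * (u k * (starRingEnd ℂ) (u l)) else 0 := by
    rw [galerkinNonlin_eq]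
    rw [← Finset.sum_subset (modesUpTo_mono h) fun k _ hk =>
      Finset.sum_eq_zero fun l _ => if_neg fun hkl => hk hkl.1]
    refine Finset.sum_congr rfl fun k hk => ?_
    rw [← Finset.sum_subset (modesUpTo_mono h) fun l _ hl => if_neg fun hkl => hl hkl.2]
    exact Finset.sum_congr rfl fun l hl => (if_pos ⟨hk, hl⟩).symm
  rw [h1, galerkinNonlin_eq, ← Finset.sum_sub_distrib]
  refine Finset.sum_congr rfl fun k _ => ?_
  rw [← Finset.sum_sub_distrib]
  refine Finset.sum_congr rfl fun l _ => ?_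
  unfold tailKernel
  split_ifs <;> simp

/-! ### Convergence of the Galerkin nonlinearities -/

theorem sobolevNorm_sq (s : ℝ) (a : Mode → ℂ) :
    sobolevNorm s a ^ 2 = ∑' m, sobolevWeight s m * ‖a m‖ₑ ^ 2 := by
  rw [sobolevNorm, ← ENNReal.rpow_natCast, ← ENNReal.rpow_mul]
  norm_num
  rfl

theorem lintegral_sobolevNorm_sq {Ω : Type*} [MeasurableSpace Ω] {P : Measure Ω} (s : ℝ)
    {a : Ω → Mode → ℂ} (ha : ∀ m, AEMeasurable (fun ω => a ω m) P) :
    ∫⁻ ω, sobolevNorm s (a ω) ^ 2 ∂P =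
      ∑' m, sobolevWeight s m * eLpNorm (fun ω => a ω m) 2 P ^ 2 := by
  simp_rw [sobolevNorm_sq]
  rw [lintegral_tsum fun m => ((ha m).enorm.pow_const 2).const_mul _]
  refine tsum_congr fun m => ?_
  rw [lintegral_const_mul'' _ ((ha m).enorm.pow_const 2), eLpNorm_two_sq]

theorem quadVar_bilinearKernel_ne_top (m : Mode) : quadVar (bilinearKernel m) ≠ ∞ := by
  -- Any positive `γ` would do for a single mode; here it is 1.
  have h := ENNReal.ne_top_of_tsum_ne_top (tsum_quadVar_ne_top one_pos) m
  exact fun h' => h (by rw [h', ENNReal.mul_top (sobolevWeight_ne_zero _ m)])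

theorem tendsto_zero_of_tsum_weight {s : ℝ} {f : ℕ → Mode → ℝ≥0∞}
    (h : Tendsto (fun n => ∑' m, sobolevWeight s m * f n m) atTop (𝓝 0)) (m : Mode) :
    Tendsto (fun n => f n m) atTop (𝓝 0) := by
  have h1 : Tendsto (fun n => sobolevWeight s m * f n m) atTop (𝓝 0) :=
    tendsto_of_tendsto_of_tendsto_of_le_of_le tendsto_const_nhds h (fun _ => zero_le)
      fun n => ENNReal.le_tsum m
  have h2 := ENNReal.Tendsto.const_mul (a := (sobolevWeight s m)⁻¹) h1
    (Or.inr (ENNReal.inv_ne_top.2 (sobolevWeight_ne_zero s m)))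
  rw [mul_zero] at h2
  refine h2.congr fun n => ?_
  rw [← mul_assoc, ENNReal.inv_mul_cancel (sobolevWeight_ne_zero s m) (sobolevWeight_ne_top s m),
    one_mul]

theorem tendsto_quadVar_tailKernel (m : Mode) :
    Tendsto (fun N => quadVar (tailKernel N m)) atTop (𝓝 0) :=
  tendsto_zero_of_tsum_weight (tendsto_tsum_quadVar_tailKernel one_pos) m

theorem exists_tendsto_eLpNorm_sub {α : Type*} [MeasurableSpace α] {μ : Measure α}
    {f : ℕ → α → ℂ} (hf : ∀ n, MemLp (f n) 2 μ) {B : ℕ → ℝ≥0∞} (hB : Tendsto B atTop (𝓝 0))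
    (h : ∀ N M, N ≤ M → eLpNorm (f M - f N) 2 μ ≤ B N) :
    ∃ g : α → ℂ, MemLp g 2 μ ∧ Tendsto (fun n => eLpNorm (f n - g) 2 μ) atTop (𝓝 0) := by
  have hc : CauchySeq fun n => (hf n).toLp (f n) := by
    refine EMetric.cauchySeq_iff_NNReal.2 fun ε hε => ?_
    obtain ⟨N, hN⟩ := (hB.eventually_lt_const (ENNReal.coe_pos.2 hε)).exists
    refine ⟨N, fun n hn => ?_⟩
    rw [Lp.edist_toLp_toLp]
    exact (h N n hn).trans_lt hN
  obtain ⟨g, hg⟩ := cauchySeq_tendsto_of_complete hc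
  refine ⟨g, Lp.memLp g, ?_⟩
  have := (Lp.tendsto_Lp_iff_tendsto_eLpNorm' _ _).1 hg
  refine this.congr fun n => eLpNorm_congr_ae ?_
  filter_upwards [(hf n).coeFn_toLp] with x hx
  simp [hx]

theorem rpow_half_sq (x : ℝ≥0∞) : (x ^ (1 / 2 : ℝ)) ^ 2 = x := by
  rw [← ENNReal.rpow_natCast, ← ENNReal.rpow_mul]
  norm_num

section

variable {Ω : Type*} [MeasurableSpace Ω] {P : Measure Ω} {β : Mode → ℝ≥0 → Ω → ℂ}
  {z : ℝ≥0 → Ω → Mode → ℂ}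

theorem IsStochasticConvolution.aemeasurable_galerkinNonlin (hz : IsStochasticConvolution P β z)
    (t : ℝ≥0) (N : ℕ) (m : Mode) :
    AEMeasurable (fun ω => galerkinNonlin N (z t ω) (z t ω) m) P := by
  simp_rw [galerkinNonlin_eq]
  refine Finset.aemeasurable_fun_sum _ fun k _ => Finset.aemeasurable_fun_sum _ fun l _ => ?_
  exact ((hz.aemeasurable t k).mul
    (Complex.continuous_conj.measurable.comp_aemeasurable (hz.aemeasurable t l))).const_mul _

theorem IsStochasticConvolution.eLpNorm_galerkinNonlin_le (hβ : IsCylindricalWiener P β)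
    (hz : IsStochasticConvolution P β z) (t : ℝ≥0) (N : ℕ) (m : Mode) {r : ℝ≥0∞} (hr : 2 ≤ r)
    (ht : r ≠ ∞) :
    eLpNorm (fun ω => galerkinNonlin N (z t ω) (z t ω) m) r P ≤
      chaosConst r * quadVar (bilinearKernel m) ^ (1 / 2 : ℝ) := by
  simp_rw [galerkinNonlin_eq]
  exact hz.eLpNorm_quadratic_le hβ t _ (bilinearKernel_self m) hr ht

theorem IsStochasticConvolution.eLpNorm_galerkinNonlin_sub_le (hβ : IsCylindricalWiener P β)
    (hz : IsStochasticConvolution P β z) (t : ℝ≥0) {N M : ℕ} (h : N ≤ M) (m : Mode) :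
    eLpNorm ((fun ω => galerkinNonlin M (z t ω) (z t ω) m) -
        fun ω => galerkinNonlin N (z t ω) (z t ω) m) 2 P ≤
      chaosConst 2 * quadVar (tailKernel N m) ^ (1 / 2 : ℝ) := by
  have : ((fun ω => galerkinNonlin M (z t ω) (z t ω) m) -
      fun ω => galerkinNonlin N (z t ω) (z t ω) m) =
      fun ω => ∑ k ∈ modesUpTo M, ∑ l ∈ modesUpTo M,
        tailKernel N m k l * (z t ω k * (starRingEnd ℂ) (z t ω l)) := by
    ext ω
    exact galerkinNonlin_sub h (z t ω) m
  rw [this]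
  exact hz.eLpNorm_quadratic_le hβ t _ (tailKernel_self N m) le_rfl (by simp)

/-- The limit is built mode by mode. The explicit rate, inherited from the Cauchy estimate by
letting `M → ∞`, is what can later be summed over `m`. -/
theorem IsStochasticConvolution.exists_limit (hβ : IsCylindricalWiener P β)
    (hz : IsStochasticConvolution P β z) (t : ℝ≥0) (m : Mode) :
    ∃ b : Ω → ℂ, AEMeasurable b P ∧ ∀ N,
      eLpNorm (fun ω => galerkinNonlin N (z t ω) (z t ω) m - b ω) 2 P ≤
        chaosConst 2 * quadVar (tailKernel N m) ^ (1 / 2 : ℝ) := by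
  let f (N : ℕ) (ω : Ω) : ℂ := galerkinNonlin N (z t ω) (z t ω) m
  let B (N : ℕ) : ℝ≥0∞ := chaosConst 2 * quadVar (tailKernel N m) ^ (1 / 2 : ℝ)
  have hfm (N : ℕ) : AEMeasurable (f N) P := hz.aemeasurable_galerkinNonlin t N m
  have hf (N : ℕ) : MemLp (f N) 2 P := by
    refine ⟨(hfm N).aestronglyMeasurable,
      (hz.eLpNorm_galerkinNonlin_le hβ t N m le_rfl (by simp)).trans_lt ?_⟩
    exact ENNReal.mul_lt_top (chaosConst_ne_top (by simp)).lt_top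
      (ENNReal.rpow_lt_top_of_nonneg (by norm_num) (quadVar_bilinearKernel_ne_top m))
  have hsub (N M : ℕ) (h : N ≤ M) : eLpNorm (f M - f N) 2 P ≤ B N :=
    hz.eLpNorm_galerkinNonlin_sub_le hβ t h m
  have hB : Tendsto B atTop (𝓝 0) := by
    have h1 : Tendsto (fun N => quadVar (tailKernel N m) ^ (1 / 2 : ℝ)) atTop (𝓝 0) := by
      have := (ENNReal.continuous_rpow_const (y := 1 / 2)).tendsto 0 |>.comp
        (tendsto_quadVar_tailKernel m)
      rwa [ENNReal.zero_rpow_of_pos (by norm_num)] at this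
    have := ENNReal.Tendsto.const_mul (a := chaosConst 2) h1
      (Or.inr (chaosConst_ne_top (by simp)))
    rwa [mul_zero] at this
  obtain ⟨b, hb, hlim⟩ := exists_tendsto_eLpNorm_sub hf hB hsub
  refine ⟨b, hb.aestronglyMeasurable.aemeasurable, fun N => ?_⟩
  have h1 : Tendsto (fun M => B N + eLpNorm (f M - b) 2 P) atTop (𝓝 (B N + 0)) :=
    tendsto_const_nhds.add hlim
  rw [add_zero] at h1
  refine ge_of_tendsto h1 ?_
  filter_upwards [eventually_ge_atTop N] with M hM
  calc eLpNorm (fun ω => f N ω - b ω) 2 P = eLpNorm ((f M - b) - (f M - f N)) 2 P := by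
        congr 1; ext ω; simp
    _ ≤ eLpNorm (f M - b) 2 P + eLpNorm (f M - f N) 2 P :=
        eLpNorm_sub_le ((hf M).sub hb).aestronglyMeasurable
          ((hf M).sub (hf N)).aestronglyMeasurable (by norm_num)
    _ ≤ B N + eLpNorm (f M - b) 2 P := by rw [add_comm]; gcongr; exact hsub N M hM

theorem IsStochasticConvolution.exists_isRenormalizedNonlin (hβ : IsCylindricalWiener P β)
    (hz : IsStochasticConvolution P β z) {γ : ℝ} (hγ : 0 < γ) :
    ∃ b : ℝ≥0 → Ω → Mode → ℂ, ∀ t, IsRenormalizedNonlin P (-2 - γ) (z t) (b t) := by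
  choose b hbm hb using fun t m => hz.exists_limit hβ t m
  refine ⟨fun t ω m => b t m ω, fun t => ⟨fun m => hbm t m, ?_⟩⟩
  have h0 : Tendsto (fun N => chaosConst 2 ^ 2 *
      ∑' m, sobolevWeight (-2 - γ) m * quadVar (tailKernel N m)) atTop (𝓝 0) := by
    have := ENNReal.Tendsto.const_mul (a := chaosConst 2 ^ 2) (tendsto_tsum_quadVar_tailKernel hγ)
      (Or.inr (ENNReal.pow_ne_top (chaosConst_ne_top (by simp))))
    simpa using this
  refine tendsto_of_tendsto_of_tendsto_of_le_of_le tendsto_const_nhds h0 (fun _ => zero_le)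
    fun N => ?_
  simp only
  rw [lintegral_sobolevNorm_sq (-2 - γ)
    (a := fun ω k => galerkinNonlin N (z t ω) (z t ω) k - b t k ω)
    fun m => (hz.aemeasurable_galerkinNonlin t N m).sub (hbm t m), ← ENNReal.tsum_mul_left]
  refine ENNReal.tsum_le_tsum fun m => ?_
  calc _ ≤ sobolevWeight (-2 - γ) m *
        (chaosConst 2 * quadVar (tailKernel N m) ^ (1 / 2 : ℝ)) ^ 2 := by
        gcongr; exact hb t m N
    _ = _ := by rw [mul_pow, rpow_half_sq]; ring

/-! ### Moments of the renormalized nonlinearity -/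

/-- This covers every version `b` of the limit: convergence in the Sobolev norm forces `L²`
convergence of each coefficient since the weights are nonzero, and Fatou's lemma transfers the bound
uniform in `N`. -/
theorem IsRenormalizedNonlin.eLpNorm_le (hβ : IsCylindricalWiener P β)
    (hz : IsStochasticConvolution P β z) {s : ℝ} {t : ℝ≥0} {b : Ω → Mode → ℂ}
    (hb : IsRenormalizedNonlin P s (z t) b) (m : Mode) {r : ℝ≥0∞} (hr : 2 ≤ r) (ht : r ≠ ∞) :
    eLpNorm (fun ω => b ω m) r P ≤ chaosConst r * quadVar (bilinearKernel m) ^ (1 / 2 : ℝ) := by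
  have hlim : Tendsto (fun N => eLpNorm ((fun ω => galerkinNonlin N (z t ω) (z t ω) m) -
      fun ω => b ω m) 2 P) atTop (𝓝 0) := by
    have h1 := hb.2
    simp_rw [fun N => lintegral_sobolevNorm_sq s
      (a := fun ω k => galerkinNonlin N (z t ω) (z t ω) k - b ω k)
      fun m => (hz.aemeasurable_galerkinNonlin t N m).sub (hb.1 m)] at h1
    have h2 := (ENNReal.continuous_rpow_const (y := 1 / 2)).tendsto 0 |>.comp
      (tendsto_zero_of_tsum_weight h1 m)
    rw [ENNReal.zero_rpow_of_pos (by norm_num)] at h2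
    refine h2.congr fun N => ?_
    simp only [Function.comp_apply]
    rw [← ENNReal.rpow_natCast, ← ENNReal.rpow_mul]
    norm_num
    rfl
  exact eLpNorm_le_of_tendsto_eLpNorm_sub (Φ := id)
    (fun N => (hz.aemeasurable_galerkinNonlin t N m).aestronglyMeasurable)
    (hb.1 m).aestronglyMeasurable hlim continuous_id tendsto_const_nhds
    fun N => hz.eLpNorm_galerkinNonlin_le hβ t N m hr ht

/-- The bound for the moment of order `2 q` of the renormalized nonlinearity. -/
def momentBound (γ q : ℝ) : ℝ≥0∞ :=
  (∑' m, sobolevWeight (-2 - γ) m *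
    (chaosConst (ENNReal.ofReal (2 * q)) ^ 2 * quadVar (bilinearKernel m))) ^ q

theorem momentBound_ne_top {γ q : ℝ} (hγ : 0 < γ) (hq : 1 ≤ q) : momentBound γ q ≠ ∞ := by
  refine ENNReal.rpow_ne_top_of_nonneg (by linarith) ?_
  simp_rw [mul_left_comm (sobolevWeight _ _)]
  rw [ENNReal.tsum_mul_left]
  exact ENNReal.mul_ne_top (ENNReal.pow_ne_top (chaosConst_ne_top ENNReal.ofReal_ne_top))
    (tsum_quadVar_ne_top hγ)

/-- The squared Sobolev norm is a weighted sum over modes, so Minkowski's inequality in `L^q`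
reduces its moment to the `L^{2q}` norms of single coefficients. -/
theorem IsRenormalizedNonlin.lintegral_sobolevNorm_rpow_le (hβ : IsCylindricalWiener P β)
    (hz : IsStochasticConvolution P β z) {γ : ℝ} {t : ℝ≥0} {b : Ω → Mode → ℂ}
    (hb : IsRenormalizedNonlin P (-2 - γ) (z t) b) {q : ℝ} (hq : 1 ≤ q) :
    ∫⁻ ω, sobolevNorm (-2 - γ) (b ω) ^ (2 * q) ∂P ≤ momentBound γ q := by
  have hq0 : 0 < q := by linarith
  set Q : ℝ≥0∞ := ENNReal.ofReal q with hQ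
  set r : ℝ≥0∞ := ENNReal.ofReal (2 * q) with hr
  have hQ1 : 1 ≤ Q := by rw [hQ, ENNReal.one_le_ofReal]; exact hq
  have hQ0 : Q ≠ 0 := (zero_lt_one.trans_le hQ1).ne'
  have hQt : Q ≠ ∞ := ENNReal.ofReal_ne_top
  have hr2 : 2 ≤ r := by
    rw [hr, show (2 : ℝ≥0∞) = ENNReal.ofReal 2 by simp]
    exact ENNReal.ofReal_le_ofReal (by linarith)
  have hQr : Q * ENNReal.ofReal 2 = r := by
    rw [hQ, hr, ← ENNReal.ofReal_mul hq0.le, mul_comm]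
  let F (ω : Ω) : ℝ≥0∞ := ∑' m, sobolevWeight (-2 - γ) m * ‖b ω m‖ₑ ^ 2
  have hF : ∫⁻ ω, sobolevNorm (-2 - γ) (b ω) ^ (2 * q) ∂P = eLpNorm F Q P ^ q := by
    rw [eLpNorm_eq_lintegral_rpow_enorm_toReal hQ0 hQt, hQ, ENNReal.toReal_ofReal hq0.le,
      ← ENNReal.rpow_mul, one_div_mul_cancel hq0.ne', ENNReal.rpow_one]
    refine lintegral_congr fun ω => ?_
    rw [enorm_eq_self, ENNReal.rpow_mul, ENNReal.rpow_ofNat, sobolevNorm_sq]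
  rw [hF, momentBound]
  gcongr
  refine (eLpNorm_tsum_le (fun m => ((hb.1 m).enorm.pow_const 2).const_mul _) hQ1 hQt).trans ?_
  refine ENNReal.tsum_le_tsum fun m => ?_
  have h1 : eLpNorm (fun ω => sobolevWeight (-2 - γ) m * ‖b ω m‖ₑ ^ 2) Q P =
      sobolevWeight (-2 - γ) m * eLpNorm (fun ω => ‖b ω m‖ₑ ^ 2) Q P := by
    simp only [eLpNorm_eq_lintegral_rpow_enorm_toReal hQ0 hQt, enorm_eq_self,
      ENNReal.mul_rpow_of_nonneg _ _ ENNReal.toReal_nonneg]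
    rw [lintegral_const_mul'' _ (((hb.1 m).enorm.pow_const 2).pow_const _),
      ENNReal.mul_rpow_of_nonneg _ _ (by positivity), ← ENNReal.rpow_mul,
      mul_one_div_cancel (ENNReal.toReal_pos hQ0 hQt).ne', ENNReal.rpow_one]
  have h2 : eLpNorm (fun ω => ‖b ω m‖ₑ ^ 2) Q P = eLpNorm (fun ω => b ω m) r P ^ 2 := by
    have := eLpNorm_enorm_rpow (p := Q) (μ := P) (fun ω => b ω m) (q := 2) (by norm_num)
    rw [hQr] at this
    simpa using this
  rw [h1, h2]
  gcongr
  calc _ ≤ (chaosConst r * quadVar (bilinearKernel m) ^ (1 / 2 : ℝ)) ^ 2 := by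
        gcongr; exact hb.eLpNorm_le hβ hz m hr2 ENNReal.ofReal_ne_top
    _ = _ := by rw [mul_pow, rpow_half_sq]

theorem rpow_le_one_add_rpow (x : ℝ≥0∞) {p r : ℝ} (hp : 0 ≤ p) (hpr : p ≤ r) :
    x ^ p ≤ 1 + x ^ r := by
  rcases le_total x 1 with h | h
  · exact (ENNReal.rpow_le_one h hp).trans le_self_add
  · exact (ENNReal.rpow_le_rpow_of_exponent_le h hpr).trans le_add_self

end

end

end SurfaceGrowth

open SurfaceGrowth

theorem proposition3p5 (γ : ℝ) (hγ : 0 < γ) (p : ℝ) (hp : 1 < p) :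
    ∃ c : ℝ, 0 < c ∧
      ∀ (Ω : Type*) [MeasurableSpace Ω] (P : Measure Ω) [IsProbabilityMeasure P]
        (β : Mode → ℝ≥0 → Ω → ℂ) (_ : IsCylindricalWiener P β)
        (z : ℝ≥0 → Ω → Mode → ℂ) (_ : IsStochasticConvolution P β z),
        (∃ b : ℝ≥0 → Ω → Mode → ℂ,
          ∀ t : ℝ≥0, 0 < t → IsRenormalizedNonlin P (-2 - γ) (z t) (b t)) ∧
        ∀ b : ℝ≥0 → Ω → Mode → ℂ,
          (∀ t : ℝ≥0, 0 < t → IsRenormalizedNonlin P (-2 - γ) (z t) (b t)) →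
          (⨆ (t : ℝ≥0) (_ : 0 < t), ∫⁻ ω, (sobolevNorm (-2 - γ) (b t ω)) ^ p ∂P)
            ≤ ENNReal.ofReal c := by
  -- The order `2q` must be at least `p`, to dominate the wanted moment, and at least 2, for the
  -- bound on quadratic forms.
  set q : ℝ := max (p / 2) 1
  have hq : 1 ≤ q := le_max_right _ _
  have hpq : p ≤ 2 * q := by linarith [le_max_left (p / 2) 1]
  have hM : 1 + momentBound γ q ≠ ∞ :=
    ENNReal.add_ne_top.2 ⟨ENNReal.one_ne_top, momentBound_ne_top hγ hq⟩
  -- The constant is fixed before the probability space and the noise. Its summand 1 is the total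
  -- mass of `P`, from `x^p ≤ 1 + x^{2q}`.
  refine ⟨(1 + momentBound γ q).toReal, ENNReal.toReal_pos (by simp) hM, ?_⟩
  intro Ω _ P _ β hβ z hz
  refine ⟨?_, fun b hb => iSup₂_le fun t ht => ?_⟩
  · obtain ⟨b, hb⟩ := hz.exists_isRenormalizedNonlin hβ hγ
    exact ⟨b, fun t _ => hb t⟩
  rw [ENNReal.ofReal_toReal hM]
  calc ∫⁻ ω, sobolevNorm (-2 - γ) (b t ω) ^ p ∂P
      ≤ ∫⁻ ω, (1 + sobolevNorm (-2 - γ) (b t ω) ^ (2 * q)) ∂P :=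
        lintegral_mono fun ω => rpow_le_one_add_rpow _ (by linarith) hpq
    _ = 1 + ∫⁻ ω, sobolevNorm (-2 - γ) (b t ω) ^ (2 * q) ∂P := by
        rw [lintegral_add_left measurable_const]; simp
    _ ≤ 1 + momentBound γ q := by
        gcongr
        exact (hb t ht).lintegral_sobolevNorm_rpow_le hβ hz hq
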